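/- **Proposition 7.1.** Let $d\ge 1$, and let $S:\mathbb R^d\times\mathbb R^d\to\mathbb R$ be a generating function, i.e. a $C^2$ map such that $S(x+r,y+r)=S(x,y)$ for all $r\in\mathbb Z^d$, and such that for some $A>0$, $$\sum_{i,j}\frac{\partial^2 S}{\partial x_i\partial y_j}(x,y)\,\xi_i\xi_j\le -A\|\xi\|^2\qquad\text{for all }x,y,\xi\in\mathbb R^d .$$ Let $\overline F$ be the diffeomorphism of $\mathbb R^d\times(\mathbb R^d)^*$ defined by $\overline F(x,p)=(x',p')\iff p=-\partial_1S(x,x')$ and $p'=\partial_2S(x,x')$, and let $F$ be the induced twist map of $T^*\mathbb T^d$, where $\mathbb T^d=\mathbb R^d/\mathbb Z^d$. Assume that $F$ is without conjugate points: for all $(x,p)\in T^*\mathbb T^d$ and all $n\in\mathbb Z\setminus\{0\}$, $$V(F^n(x,p))\cap DF^n(x,p)\cdot V(x,p)=\{0\},$$ where $V$ denotes the kernel of the differential of the projection $T^*\mathbb T^d\to\mathbb T^d$. For a function $L:\mathbb R^d\times\mathbb R^d\to\mathbb R$, write $L(x_0,\dots,x_n)=\sum_{k<n}L(x_k,x_{k+1})$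 and $\overline L=\inf\,\liminf_{n\to\infty}\frac1n L(x_0,\dots,x_n)$, the infimum being over all sequences $(x_n)_{n\in\mathbb N}$ in $\mathbb R^d$. The Aubry set of $L$ is the set of $(x,y)\in\mathbb R^d\times\mathbb R^d$ such that for every $\varepsilon>0$ there are $n\ge1$ and $x_0,\dots,x_n\in\mathbb R^d$ with $x_n-x_0\in\mathbb Z^d$, $\|x-x_0\|<\varepsilon$, $\|y-x_1\|<\varepsilon$ and $L(x_0,\dots,x_n)-n\overline L<\varepsilon$. For $c\in H^1(\mathbb T^d,\mathbb R)$ let $\overline{\mathcal A}_c$ be the Aubry set of $S_u(x,y)=S(x,y)+u(x)-u(y)$, where $u$ is a primitive on $\mathbb R^d$ of the lift of a smooth closed 1-form on $\mathbb T^d$ of class $c$ (this set does not depend on the choice of $u$). Let the dual Aubry set $\mathcal A_c^*\subset T^*\mathbb T^d$ be the projection to $T^*\mathbb T^d$ of $\{(x,-\partial_1S(x,y)) : (x,y)\in\overline{\mathcal A}_c\}$. If $c,c'\in H^1(\mathbb T^d,\mathbb R)$ and $c\ne c'$, then $\mathcal A_c^*\cap\mathcal A_{c'}^*=\varnothing$.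 -/

import Mathlib

open scoped ContDiff Topology
open Filter

namespace TwistMap

/-- The Euclidean space `ℝ^d`. -/
abbrev E (d : ℕ) : Type := EuclideanSpace ℝ (Fin d)

/-- The dual space `(ℝ^d)^*`. -/
abbrev Dual (d : ℕ) : Type := E d →L[ℝ] ℝ

/-- The vector of `ℝ^d` with the integer coordinates `r`, an element of the lattice `ℤ^d ⊂ ℝ^d`. -/
def latticeVec {d : ℕ} (r : Fin d → ℤ) : E d := WithLp.toLp 2 fun i => (r i : ℝ)

/-- A generating function: a `C^2` function on `ℝ^d × ℝ^d`, invariant under the diagonal action of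
`ℤ^d`, satisfying the uniform twist condition. The bilinear form
`∑ i j, ∂²S/∂x_i∂y_j (x, y) ξ_i ξ_j` is the second derivative of `S` at `(x, y)` evaluated
at `(ξ, 0)` and `(0, ξ)`. -/
structure GeneratingFunction (d : ℕ) where
  toFun : E d × E d → ℝ
  contDiff : ContDiff ℝ 2 toFun
  periodic : ∀ (r : Fin d → ℤ) (x y : E d),
    toFun (x + latticeVec r, y + latticeVec r) = toFun (x, y)
  twist : ∃ A : ℝ, 0 < A ∧ ∀ x y ξ : E d,
    fderiv ℝ (fderiv ℝ toFun) (x, y) (ξ, 0) (0, ξ) ≤ -A * ‖ξ‖ ^ 2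

/-! ### A global inversion fact, needed to construct the twist map -/

theorem bijective_of_fderiv_neg {d : ℕ} (g : E d → Dual d) (hg : ContDiff ℝ 1 g) {A : ℝ}
    (hA : 0 < A) (h : ∀ x ξ : E d, fderiv ℝ g x ξ ξ ≤ -A * ‖ξ‖ ^ 2) :
    Function.Bijective g := by
  have hd : Differentiable ℝ g := hg.differentiable (by norm_num)
  have key : ∀ x y : E d, A * ‖x - y‖ ≤ ‖g x - g y‖ := by
    intro x y
    let f : ℝ → ℝ := fun t => g (y + t • (x - y)) (x - y)
    have hf : ∀ t, HasDerivAt f (fderiv ℝ g (y + t • (x - y)) (x - y) (x - y)) t := by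
      intro t
      have h1 : HasDerivAt (fun t : ℝ => y + t • (x - y)) (x - y) t := by
        simpa using ((hasDerivAt_id t).smul_const (x - y)).const_add y
      have h2 := (hd (y + t • (x - y))).hasFDerivAt.comp_hasDerivAt t h1
      exact ((ContinuousLinearMap.apply ℝ ℝ (x - y)).hasFDerivAt.comp_hasDerivAt t h2)
    obtain ⟨t, -, ht⟩ := exists_hasDerivAt_eq_slope f
      (fun t => fderiv ℝ g (y + t • (x - y)) (x - y) (x - y)) (zero_lt_one' ℝ)
      (fun t _ => (hf t).continuousAt.continuousWithinAt) (fun t _ => hf t)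
    have h3 := h (y + t • (x - y)) (x - y)
    have h4 : f 1 - f 0 = (g x - g y) (x - y) := by simp [f]
    have h5 : -(‖g x - g y‖ * ‖x - y‖) ≤ (g x - g y) (x - y) :=
      neg_le_of_abs_le ((g x - g y).le_opNorm (x - y))
    have h6 : A * ‖x - y‖ ^ 2 ≤ ‖g x - g y‖ * ‖x - y‖ := by
      simp only [sub_zero, div_one] at ht
      linarith
    rcases (norm_nonneg (x - y)).eq_or_lt with h0 | h0
    · rw [← h0]; simp
    · nlinarith
  have hanti : AntilipschitzWith (Real.toNNReal A⁻¹) g := by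
    refine AntilipschitzWith.of_le_mul_dist fun x y => ?_
    rw [Real.coe_toNNReal _ (by positivity), dist_eq_norm, dist_eq_norm, inv_mul_eq_div,
      le_div_iff₀ hA, mul_comm]
    exact key x y
  refine ⟨hanti.injective, ?_⟩
  have hclosed : IsClosed (Set.range g) := by
    have ht : Tendsto g (cocompact _) (cocompact _) := by
      rw [← Metric.cobounded_eq_cocompact, ← Metric.cobounded_eq_cocompact]
      exact hanti.tendsto_cobounded
    exact (isProperMap_iff_tendsto_cocompact.2 ⟨hg.continuous, ht⟩).isClosedMap.isClosed_range
  have hopen : IsOpen (Set.range g) := by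
    refine (isOpenMap_iff_nhds_le.2 fun x => ?_).isOpen_range
    have hs : HasStrictFDerivAt g (fderiv ℝ g x) x := hg.hasStrictFDerivAt (by norm_num)
    have hinj : Function.Injective (fderiv ℝ g x : E d →ₗ[ℝ] Dual d) := by
      rw [injective_iff_map_eq_zero]
      intro ξ hξ
      have h1 := h x ξ
      have h2 : fderiv ℝ g x ξ = 0 := hξ
      rw [h2] at h1
      simp only [zero_apply] at h1
      have : ‖ξ‖ ^ 2 ≤ 0 := by nlinarith [sq_nonneg ‖ξ‖]
      simpa using this
    have hdim : Module.finrank ℝ (E d) = Module.finrank ℝ (Dual d) :=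
      (InnerProductSpace.toDual ℝ (E d)).toLinearEquiv.finrank_eq
    have hsurj := (LinearMap.injective_iff_surjective_of_finrank_eq_finrank hdim).1 hinj
    exact (hs.map_nhds_eq_of_surj (LinearMap.range_eq_top.2 hsurj)).ge
  exact Set.range_eq_univ.1 (IsClopen.eq_univ ⟨hclosed, hopen⟩ (Set.range_nonempty g))

namespace GeneratingFunction

variable {d : ℕ} (S : GeneratingFunction d)

/-- The partial differential `∂₁S(x, y) ∈ (ℝ^d)^*` with respect to the first variable. -/
noncomputable def d₁ (x y : E d) : Dual d :=
  (fderiv ℝ S.toFun (x, y)).comp (ContinuousLinearMap.inl ℝ (E d) (E d))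

/-- The partial differential `∂₂S(x, y) ∈ (ℝ^d)^*` with respect to the second variable. -/
noncomputable def d₂ (x y : E d) : Dual d :=
  (fderiv ℝ S.toFun (x, y)).comp (ContinuousLinearMap.inr ℝ (E d) (E d))

theorem d₁_bijective (x : E d) : Function.Bijective fun y => S.d₁ x y := by
  obtain ⟨A, hA, h⟩ := S.twist
  have hS : ContDiff ℝ 1 (fderiv ℝ S.toFun) := S.contDiff.fderiv_right (by norm_num)
  have hc : ContDiff ℝ 1 fun y : E d => fderiv ℝ S.toFun (x, y) :=
    hS.comp (contDiff_const.prodMk contDiff_id)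
  refine bijective_of_fderiv_neg _ (hc.clm_comp contDiff_const) hA fun y ξ => ?_
  have h1 : HasFDerivAt (fun y : E d => (x, y)) (ContinuousLinearMap.inr ℝ (E d) (E d)) y :=
    (hasFDerivAt_const x y).prodMk (hasFDerivAt_id y)
  have h2 := ((hS.differentiable (by norm_num)) (x, y)).hasFDerivAt.comp y h1
  have h3 := (((ContinuousLinearMap.compL ℝ (E d) (E d × E d) ℝ).flip
    (ContinuousLinearMap.inl ℝ (E d) (E d))).hasFDerivAt.comp y h2).fderiv
  have hsymm : IsSymmSndFDerivAt ℝ S.toFun (x, y) :=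
    S.contDiff.contDiffAt.isSymmSndFDerivAt (by simp)
  have h4 : fderiv ℝ (fun y => S.d₁ x y) y ξ ξ
      = fderiv ℝ (fderiv ℝ S.toFun) (x, y) (0, ξ) (ξ, 0) := by
    have := congrArg (fun L => L ξ ξ) h3
    simpa [Function.comp_def, d₁] using this
  rw [h4, hsymm.eq]
  exact h x y ξ

theorem d₂_bijective (y : E d) : Function.Bijective fun x => S.d₂ x y := by
  obtain ⟨A, hA, h⟩ := S.twist
  have hS : ContDiff ℝ 1 (fderiv ℝ S.toFun) := S.contDiff.fderiv_right (by norm_num)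
  have hc : ContDiff ℝ 1 fun x : E d => fderiv ℝ S.toFun (x, y) :=
    hS.comp (contDiff_id.prodMk contDiff_const)
  refine bijective_of_fderiv_neg _ (hc.clm_comp contDiff_const) hA fun x ξ => ?_
  have h1 : HasFDerivAt (fun x : E d => (x, y)) (ContinuousLinearMap.inl ℝ (E d) (E d)) x :=
    (hasFDerivAt_id x).prodMk (hasFDerivAt_const y x)
  have h2 := ((hS.differentiable (by norm_num)) (x, y)).hasFDerivAt.comp x h1
  have h3 := (((ContinuousLinearMap.compL ℝ (E d) (E d × E d) ℝ).flip
    (ContinuousLinearMap.inr ℝ (E d) (E d))).hasFDerivAt.comp x h2).fderiv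
  have h4 : fderiv ℝ (fun x => S.d₂ x y) x ξ ξ
      = fderiv ℝ (fderiv ℝ S.toFun) (x, y) (ξ, 0) (0, ξ) := by
    have := congrArg (fun L => L ξ ξ) h3
    simpa [Function.comp_def, d₂] using this
  rw [h4]
  exact h x y ξ

/-- The bijection `ℒ : (x, y) ↦ (x, -∂₁S(x, y))` from `ℝ^d × ℝ^d` onto `ℝ^d × (ℝ^d)^*`. -/
noncomputable def legendre : E d × E d ≃ E d × Dual d :=
  Equiv.ofBijective (fun z => (z.1, -S.d₁ z.1 z.2)) <| by
    constructor
    · rintro ⟨x, y⟩ ⟨x', y'⟩ h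
      obtain ⟨rfl, h2⟩ := Prod.mk.inj h
      exact congrArg (Prod.mk x) ((S.d₁_bijective x).1 (neg_injective h2))
    · rintro ⟨x, p⟩
      obtain ⟨y, hy⟩ := (S.d₁_bijective x).2 (-p)
      refine ⟨(x, y), ?_⟩
      have hy' : S.d₁ x y = -p := hy
      simp [hy']

/-- The bijection `(x, y) ↦ (y, ∂₂S(x, y))` from `ℝ^d × ℝ^d` onto `ℝ^d × (ℝ^d)^*`. -/
noncomputable def legendre' : E d × E d ≃ E d × Dual d :=
  Equiv.ofBijective (fun z => (z.2, S.d₂ z.1 z.2)) <| by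
    constructor
    · rintro ⟨x, y⟩ ⟨x', y'⟩ h
      obtain ⟨rfl, h2⟩ := Prod.mk.inj h
      exact congrArg (fun t => (t, y)) ((S.d₂_bijective y).1 h2)
    · rintro ⟨y, p⟩
      obtain ⟨x, hx⟩ := (S.d₂_bijective y).2 p
      exact ⟨(x, y), congrArg (Prod.mk y) hx⟩

/-- The lift to `T^*ℝ^d = ℝ^d × (ℝ^d)^*` of the twist map `F : T^*𝕋^d → T^*𝕋^d` generated
by `S`; see `twistMap_eq_iff` for its implicit definition. -/
noncomputable def twistMap : Equiv.Perm (E d × Dual d) :=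
  S.legendre.symm.trans S.legendre'

/-- The implicit definition of the twist map:
`F(x, p) = (x', p')` if and only if `p = -∂₁S(x, x')` and `p' = ∂₂S(x, x')`. -/
theorem twistMap_eq_iff (x x' : E d) (p p' : Dual d) :
    S.twistMap (x, p) = (x', p') ↔ p = -S.d₁ x x' ∧ p' = S.d₂ x x' := by
  constructor
  · intro h
    obtain ⟨⟨a, b⟩, hab⟩ := S.legendre.surjective (x, p)
    rw [← hab] at h
    simp only [twistMap, Equiv.trans_apply, Equiv.symm_apply_apply] at h
    obtain ⟨h1, h2⟩ := Prod.mk.inj (show (a, -S.d₁ a b) = (x, p) from hab)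
    obtain ⟨h3, h4⟩ := Prod.mk.inj (show (b, S.d₂ a b) = (x', p') from h)
    subst h1 h3
    exact ⟨h2.symm, h4.symm⟩
  · rintro ⟨rfl, rfl⟩
    have : (x, -S.d₁ x x') = S.legendre (x, x') := rfl
    rw [this]
    simp only [twistMap, Equiv.trans_apply, Equiv.symm_apply_apply]
    rfl

end GeneratingFunction

/-- The vertical space at any point of `T^*ℝ^d`: the kernel of the differential of the projection
`(x, p) ↦ x`. The tangent spaces of `T^*ℝ^d` (and, through the covering `T^*ℝ^d → T^*𝕋^d`, those
of `T^*𝕋^d`) are all identified with `ℝ^d × (ℝ^d)^*`. -/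
def vertical (d : ℕ) : Submodule ℝ (E d × Dual d) :=
  LinearMap.ker (LinearMap.fst ℝ (E d) (Dual d))

/-- The twist map has no conjugate points: for all `z` and all `n ∈ ℤ \ {0}`, the vertical space at
`F^n(z)` and the image under `DF^n(z)` of the vertical space at `z` meet only in `0`. The condition
is expressed on the lift of `F`; since `T^*ℝ^d → T^*𝕋^d` is a covering that intertwines the two maps
and preserves vertical spaces, it is the same condition as on `T^*𝕋^d`. -/
def GeneratingFunction.WithoutConjugatePoints {d : ℕ} (S : GeneratingFunction d) : Prop :=
  ∀ (z : E d × Dual d) (n : ℤ), n ≠ 0 →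
    vertical d ⊓ (vertical d).map
      (fderiv ℝ (⇑(S.twistMap ^ n)) z : E d × Dual d →ₗ[ℝ] E d × Dual d) = ⊥

/-! ### The first de Rham cohomology group of the torus

Differential forms on `𝕋^d = ℝ^d / ℤ^d` are represented by their lifts to `ℝ^d`, that is by
`ℤ^d`-periodic forms on `ℝ^d`. -/

/-- The space of smooth closed 1-forms on `𝕋^d`. -/
def closedForms (d : ℕ) : Submodule ℝ (E d → Dual d) where
  carrier := {η | ContDiff ℝ ∞ η ∧ (∀ (r : Fin d → ℤ) (x : E d), η (x + latticeVec r) = η x) ∧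
    ∀ x v w : E d, fderiv ℝ η x v w = fderiv ℝ η x w v}
  zero_mem' := by
    refine ⟨contDiff_const, fun _ _ => rfl, fun x v w => ?_⟩
    have : (0 : E d → Dual d) = fun _ => 0 := rfl
    simp [this]
  add_mem' := by
    rintro η θ ⟨h1, h2, h3⟩ ⟨k1, k2, k3⟩
    refine ⟨h1.add k1, fun r x => by simp [h2 r x, k2 r x], fun x v w => ?_⟩
    rw [fderiv_add (h1.differentiable (by simp) x) (k1.differentiable (by simp) x)]
    simp [h3 x v w, k3 x v w]
  smul_mem' := by
    rintro a η ⟨h1, h2, h3⟩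
    refine ⟨contDiff_const.smul h1, fun r x => by simp [h2 r x], fun x v w => ?_⟩
    rw [fderiv_const_smul (h1.differentiable (by simp) x)]
    simp [h3 x v w]

/-- The space of exact 1-forms on `𝕋^d`: the differentials of smooth functions on `𝕋^d`. -/
def exactForms (d : ℕ) : Submodule ℝ (E d → Dual d) where
  carrier := {η | ∃ f : E d → ℝ, ContDiff ℝ ∞ f ∧
    (∀ (r : Fin d → ℤ) (x : E d), f (x + latticeVec r) = f x) ∧ fderiv ℝ f = η}
  zero_mem' := ⟨fun _ => 0, contDiff_const, fun _ _ => rfl, by ext1 x; simp⟩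
  add_mem' := by
    rintro η θ ⟨f, h1, h2, rfl⟩ ⟨g, k1, k2, rfl⟩
    refine ⟨f + g, h1.add k1, fun r x => by simp [h2 r x, k2 r x], ?_⟩
    ext1 x
    exact fderiv_add (h1.differentiable (by simp) x) (k1.differentiable (by simp) x)
  smul_mem' := by
    rintro a η ⟨f, h1, h2, rfl⟩
    refine ⟨a • f, contDiff_const.smul h1, fun r x => by simp [h2 r x], ?_⟩
    ext1 x
    exact fderiv_const_smul (h1.differentiable (by simp) x) a

set_option maxSynthPendingDepth 5 in
/-- The cohomology group `H¹(𝕋^d, ℝ)`: closed 1-forms modulo exact 1-forms. -/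
abbrev H1 (d : ℕ) : Type :=
  closedForms d ⧸ (exactForms d).comap (closedForms d).subtype

set_option maxSynthPendingDepth 5 in
/-- `u` is a primitive on `ℝ^d` of the lift of a closed 1-form on `𝕋^d` with cohomology
class `c`. -/
def IsPrimitive {d : ℕ} (u : E d → ℝ) (c : H1 d) : Prop :=
  ContDiff ℝ ∞ u ∧ ∃ η : closedForms d, Submodule.Quotient.mk η = c ∧ fderiv ℝ u = η

/-! ### Aubry sets -/

/-- The action `S(x_0, …, x_n) = ∑_{k < n} S(x_k, x_{k+1})`; it only involves the first `n + 1` terms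
of the sequence `x`. -/
def action {d : ℕ} (S : E d × E d → ℝ) (x : ℕ → E d) (n : ℕ) : ℝ :=
  ∑ k ∈ Finset.range n, S (x k, x (k + 1))

/-- The minimizing holonomic value: the infimum over all sequences `x` in `ℝ^d` of
`liminf_{n → ∞} S(x_0, …, x_n) / n`. The lower limit may be `+∞` for some sequences, hence the
passage through the extended reals; for a generating function the infimum is a real number. -/
noncomputable def holonomicValue {d : ℕ} (S : E d × E d → ℝ) : ℝ :=
  (⨅ x : ℕ → E d, liminf (fun n : ℕ => ((action S x n / n : ℝ) : EReal)) atTop).toReal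

/-- The Aubry set of `S` in `ℝ^d × ℝ^d`: the set of `(x, y)` such that for every `ε > 0` there are
`n ≥ 1` and `(x_0, …, x_n)` with `x_n - x_0 ∈ ℤ^d`, `‖x - x_0‖ < ε`, `‖y - x_1‖ < ε` and normalized
action less than `ε`. -/
def aubrySet {d : ℕ} (S : E d × E d → ℝ) : Set (E d × E d) :=
  {z | ∀ ε : ℝ, 0 < ε → ∃ (n : ℕ) (x : ℕ → E d), 1 ≤ n ∧ (∃ r, x n - x 0 = latticeVec r) ∧
    ‖z.1 - x 0‖ < ε ∧ ‖z.2 - x 1‖ < ε ∧ action S x n - n * holonomicValue S < ε}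

/-- The function `S_u(x, y) = S(x, y) + u(x) - u(y)`. -/
def shift {d : ℕ} (S : E d × E d → ℝ) (u : E d → ℝ) : E d × E d → ℝ :=
  fun z => S z + u z.1 - u z.2

/-- The covering `T^*ℝ^d → T^*𝕋^d = 𝕋^d × (ℝ^d)^*`, where `𝕋^d = (ℝ/ℤ)^d`. -/
def cover {d : ℕ} (z : E d × Dual d) : UnitAddTorus (Fin d) × Dual d :=
  (fun i => ((z.1 i : ℝ) : UnitAddCircle), z.2)

namespace GeneratingFunction

variable {d : ℕ} (S : GeneratingFunction d)

/-- The Aubry set associated to a cohomology class `c`: the Aubry set of `S_u`, where `u` is any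
primitive of the lift of a closed 1-form representing `c` (the set does not depend on the choice
of `u`). -/
def aubrySetOfClass (c : H1 d) : Set (E d × E d) :=
  {z | ∃ u, IsPrimitive u c ∧ z ∈ aubrySet (shift S.toFun u)}

/-- The dual Aubry set associated to a cohomology class `c`: the projection to `T^*𝕋^d` of the image
under `ℒ` of the Aubry set associated to `c`. -/
def dualAubrySet (c : H1 d) : Set (UnitAddTorus (Fin d) × Dual d) :=
  cover '' (S.legendre '' S.aubrySetOfClass c)

end GeneratingFunction

end TwistMap

/-! Without conjugate points, stationary configurations are exactly the minimizing ones. The second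
variation with fixed endpoints is nondegenerate wherever it is nonnegative, because a null vector
would be a Jacobi field vanishing at both ends. The orbits where it is nonnegative therefore form a
clopen set, nonempty since minimizers exist, so the second variation is positive definite along
every orbit (`actionHess_orbit_pos`). The action with fixed endpoints is then a coercive function
all of whose critical points are nondegenerate minima, and such a function has only one critical
point (`eq_of_fderiv_eq_zero_of_hessian_pos`).

It follows that the minimal action of a loop with `n` steps and displacement `r` does not depend on
its base point (`exists_loop_action_le`). At a base point maximizing this minimal action the loop
closes up to a stationary, hence minimizing, periodic configuration. Comparing it with many turns of
a loop based elsewhere shows that the maximum is also the minimum.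

Now let the two dual Aubry sets meet. For each class, a continuous periodic critical subsolution `v`
gives `φ = u + v` such that `S(x, y) + φ(x) - φ(y) - l ≥ 0`. The orbit of the common point has only
edges of zero cost for both reductions, and its recurrence modulo the lattice produces loops that
are almost free for both. Since the cost of a loop differs from its action by a constant depending
only on `(n, r)`, such loops exist at every base point `x`. In the limit, every `x` has a successor
`y` and a predecessor `w` joined to it by edges of zero cost for both reductions
(`exists_calibrated_edges`). The variation of `φ - φ'` near `x` is then dominated by that of `S(w,
·) + S(·, y)`, which is differentiable and minimal at `x`. So `φ - φ'` has zero derivative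
everywhere and is constant; `u₁ - u₂` is thus periodic and the classes coincide. -/

namespace TwistMap

/-! ### Coercive functions whose critical points are all nondegenerate minima -/

section UniqueCriticalPoint

variable {V : Type*} [NormedAddCommGroup V] [InnerProductSpace ℝ V] [FiniteDimensional ℝ V]

/-- By compactness of the unit sphere the Hessian is at least `2c`. The first-order expansion of the
derivative loses at most `c` on a small ball, and integration along rays gives the growth of `f`. -/
theorem exists_ball_growth_of_hessian_pos {f : V → ℝ} (hf : ContDiff ℝ 2 f) {X : V}
    (hX : fderiv ℝ f X = 0) (hpos : ∀ ξ, ξ ≠ 0 → 0 < fderiv ℝ (fderiv ℝ f) X ξ ξ) :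
    ∃ ρ > 0, ∃ c > 0, ∀ z ∈ Metric.ball X ρ,
      c * ‖z - X‖ ^ 2 ≤ fderiv ℝ f z (z - X) ∧ c / 2 * ‖z - X‖ ^ 2 ≤ f z - f X := by
  have hf1 : ContDiff ℝ 1 (fderiv ℝ f) := hf.fderiv_right (by norm_num)
  have hfd : Differentiable ℝ f := hf.differentiable (by norm_num)
  have hd := (hf1.differentiable (by norm_num) X).hasFDerivAt
  set H := fderiv ℝ (fderiv ℝ f) X with hH
  obtain ⟨c, hc, hcH⟩ : ∃ c > 0, ∀ ξ, 2 * c * ‖ξ‖ ^ 2 ≤ H ξ ξ := by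
    rcases subsingleton_or_nontrivial V with hV | hV
    · refine ⟨1, one_pos, fun ξ => ?_⟩
      rw [Subsingleton.elim ξ 0]; simp
    · have hcont : Continuous fun ξ : V => H ξ ξ := by fun_prop
      obtain ⟨ξ₀, h0, hmin⟩ := (isCompact_sphere (0 : V) 1).exists_isMinOn
        (NormedSpace.sphere_nonempty.2 zero_le_one) hcont.continuousOn
      have hξ₀ : ξ₀ ≠ 0 := by
        rintro rfl; simp at h0
      refine ⟨H ξ₀ ξ₀ / 2, half_pos (hpos _ hξ₀), fun ξ => ?_⟩
      rcases eq_or_ne ξ 0 with rfl | hξ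
      · simp
      have hn : 0 < ‖ξ‖ := norm_pos_iff.2 hξ
      have h1 : H ξ₀ ξ₀ ≤ H (‖ξ‖⁻¹ • ξ) (‖ξ‖⁻¹ • ξ) := by
        apply hmin
        simp [norm_smul, hn.ne']
      simp only [map_smul, smul_apply, smul_eq_mul] at h1
      have h2 : ‖ξ‖⁻¹ * (‖ξ‖⁻¹ * H ξ ξ) = H ξ ξ / ‖ξ‖ ^ 2 := by field_simp
      rw [h2, le_div_iff₀ (by positivity)] at h1
      linarith
  have ho := (hasFDerivAt_iff_isLittleO.1 hd).def hc
  rw [Metric.eventually_nhds_iff_ball] at ho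
  obtain ⟨ρ, hρ, ho⟩ := ho
  have key : ∀ z ∈ Metric.ball X ρ, c * ‖z - X‖ ^ 2 ≤ fderiv ℝ f z (z - X) := by
    intro z hz
    have h1 := ho z hz
    rw [hX, sub_zero] at h1
    have h2 : -(‖fderiv ℝ f z - H (z - X)‖ * ‖z - X‖) ≤ (fderiv ℝ f z - H (z - X)) (z - X) :=
      neg_le_of_abs_le ((fderiv ℝ f z - H (z - X)).le_opNorm (z - X))
    have h3 := hcH (z - X)
    have h4 : (fderiv ℝ f z - H (z - X)) (z - X) = fderiv ℝ f z (z - X) - H (z - X) (z - X) := rfl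
    have h5 := mul_le_mul_of_nonneg_right h1 (norm_nonneg (z - X))
    nlinarith
  refine ⟨ρ, hρ, c, hc, fun z hz => ⟨key z hz, ?_⟩⟩
  set w := z - X with hw
  let φ : ℝ → ℝ := fun t => f (X + t • w) - c / 2 * ‖w‖ ^ 2 * t ^ 2
  have hφ : ∀ t, HasDerivAt φ (fderiv ℝ f (X + t • w) w - c * ‖w‖ ^ 2 * t) t := by
    intro t
    have h1 : HasDerivAt (fun t : ℝ => X + t • w) w t := by
      simpa using ((hasDerivAt_id t).smul_const w).const_add X
    have h2 := (hfd (X + t • w)).hasFDerivAt.comp_hasDerivAt t h1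
    have h3 := ((hasDerivAt_pow 2 t).const_mul (c / 2 * ‖w‖ ^ 2))
    refine (h2.sub h3).congr_deriv ?_
    simp; ring
  have hmono : MonotoneOn φ (Set.Icc 0 1) := by
    refine monotoneOn_of_deriv_nonneg (convex_Icc 0 1)
      (fun t _ => (hφ t).continuousAt.continuousWithinAt)
      (fun t _ => (hφ t).differentiableAt.differentiableWithinAt) fun t ht => ?_
    rw [interior_Icc] at ht
    rw [(hφ t).deriv]
    have hmem : X + t • w ∈ Metric.ball X ρ := by
      rw [Metric.mem_ball, dist_eq_norm] at hz ⊢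
      rw [add_sub_cancel_left, norm_smul, Real.norm_of_nonneg ht.1.le]
      have : t * ‖w‖ ≤ 1 * ‖w‖ := by gcongr; exact ht.2.le
      rw [← hw] at hz
      linarith
    have h1 := key _ hmem
    rw [add_sub_cancel_left, norm_smul, Real.norm_of_nonneg ht.1.le, map_smul, smul_eq_mul] at h1
    have h2 : t * (c * ‖w‖ ^ 2 * t) ≤ t * fderiv ℝ f (X + t • w) w := by linarith
    have := le_of_mul_le_mul_left h2 ht.1
    linarith
  have := hmono (by simp) (by simp) zero_le_one
  simp only [φ, zero_smul, add_zero, one_smul] at this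
  have hz' : X + w = z := by simp [hw]
  rw [hz'] at this
  linarith

/-- Run gradient descent with a fixed step on a compact sublevel set `K` containing the segment from
`X` to `Y`. Every critical point attracts a neighbourhood, so the basins are open. They are disjoint
because limits are unique, and they cover `K` because every trajectory accumulates at a critical
point. The segment is connected, so it lies in a single basin. -/
theorem eq_of_fderiv_eq_zero_of_hessian_pos {f : V → ℝ} (hf : ContDiff ℝ 2 f)
    (hco : Tendsto f (cocompact V) atTop)
    (hpos : ∀ X, fderiv ℝ f X = 0 → ∀ ξ, ξ ≠ 0 → 0 < fderiv ℝ (fderiv ℝ f) X ξ ξ)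
    {X Y : V} (hX : fderiv ℝ f X = 0) (hY : fderiv ℝ f Y = 0) : X = Y := by
  have hf1 : ContDiff ℝ 1 (fderiv ℝ f) := hf.fderiv_right (by norm_num)
  have hfd : Differentiable ℝ f := hf.differentiable (by norm_num)
  have hfc : Continuous f := hf.continuous
  obtain ⟨M, hM⟩ : ∃ M, ∀ z ∈ segment ℝ X Y, f z ≤ M := by
    have hc : IsCompact (segment ℝ X Y) := by
      rw [segment_eq_image_lineMap]
      exact isCompact_Icc.image (AffineMap.lineMap_continuous)
    obtain ⟨M, hM⟩ := (hc.image hfc).bddAbove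
    exact ⟨M, fun z hz => hM ⟨z, hz, rfl⟩⟩
  set K := {z | f z ≤ M} with hKdef
  have hKc : IsCompact K := by
    have h1 : ∀ᶠ z in cocompact V, M < f z := hco.eventually_gt_atTop M
    obtain ⟨t, ht, hts⟩ := mem_cocompact.1 h1
    refine ht.of_isClosed_subset (isClosed_le hfc continuous_const) fun z hz => ?_
    by_contra h
    exact absurd (show M < f z from hts h) (not_lt.2 hz)
  let g : V → V := fun z => (InnerProductSpace.toDual ℝ V).symm (fderiv ℝ f z)
  have hgc : Continuous g := (LinearIsometryEquiv.continuous _).comp hf1.continuous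
  have hgn : ∀ z, ‖g z‖ = ‖fderiv ℝ f z‖ := fun z => LinearIsometryEquiv.norm_map _ _
  have hgg : ∀ z, fderiv ℝ f z (g z) = ‖g z‖ ^ 2 := by
    intro z
    rw [← real_inner_self_eq_norm_sq]
    conv_lhs => rw [← (InnerProductSpace.toDual ℝ V).apply_symm_apply (fderiv ℝ f z)]
    exact InnerProductSpace.toDual_apply_apply
  obtain ⟨R, hR⟩ := hKc.isBounded.subset_closedBall (0 : V)
  obtain ⟨G, hG⟩ := (hKc.image (hgc.norm)).bddAbove
  have hG' : ∀ z ∈ K, ‖g z‖ ≤ G := fun z hz => hG ⟨z, hz, rfl⟩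
  -- `K` lies in the ball of radius `R` and a descent step of size at most 1 moves a point of `K` by
  -- at most `G`. The ball of radius `R + G` thus contains `K`, its image and the segments between
  -- them; `L` bounds the Hessian there.
  obtain ⟨L₀, hL₀⟩ := ((isCompact_closedBall (0 : V) (R + G)).image
    ((hf1.continuous_fderiv (by norm_num)).norm)).bddAbove
  set L := max L₀ 1 with hLdef
  have hL1 : 1 ≤ L := le_max_right _ _
  have hLip : ∀ a ∈ Metric.closedBall (0 : V) (R + G), ∀ b ∈ Metric.closedBall (0 : V) (R + G),
      ‖fderiv ℝ f b - fderiv ℝ f a‖ ≤ L * ‖b - a‖ := by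
    intro a ha b hb
    exact (convex_closedBall (0 : V) (R + G)).norm_image_sub_le_of_norm_fderiv_le
      (fun z _ => hf1.differentiable (by norm_num) z)
      (fun z hz => (hL₀ ⟨z, hz, rfl⟩).trans (le_max_left _ _)) ha hb
  have hX_mem : X ∈ K := hM X (left_mem_segment ℝ X Y)
  have hG0 : 0 ≤ G := (norm_nonneg _).trans (hG' X hX_mem)
  have hKb : ∀ z ∈ K, z ∈ Metric.closedBall (0 : V) (R + G) := fun z hz =>
    Metric.closedBall_subset_closedBall (by linarith) (hR hz)
  set η := 1 / (2 * L) with hη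
  have hη0 : 0 < η := by positivity
  have hηL : η * L = 1 / 2 := by rw [hη]; field_simp
  have hη1 : η ≤ 1 := by nlinarith
  let T : V → V := fun z => z - η • g z
  have hTc : Continuous T := continuous_id.sub (hgc.const_smul η)
  have hTn : ∀ z, ‖T z - z‖ = η * ‖g z‖ := by
    intro z
    simp only [T, sub_sub_cancel_left, norm_neg, norm_smul, Real.norm_of_nonneg hη0.le]
  have hTb : ∀ z ∈ K, T z ∈ Metric.closedBall (0 : V) (R + G) := by
    intro z hz
    have h1 := hR hz
    rw [mem_closedBall_zero_iff] at h1 ⊢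
    have h2 : ‖T z‖ ≤ ‖z‖ + ‖T z - z‖ := by
      simpa using norm_add_le z (T z - z)
    rw [hTn] at h2
    have h3 := hG' z hz
    nlinarith [norm_nonneg (g z)]
  have hdesc : ∀ z ∈ K, f (T z) ≤ f z - η / 2 * ‖g z‖ ^ 2 := by
    intro z hz
    obtain ⟨y, hy, hyz⟩ := domain_mvt (f := f) (f' := fderiv ℝ f)
      (s := Metric.closedBall (0 : V) (R + G))
      (fun x _ => (hfd x).hasFDerivAt.hasFDerivWithinAt)
      (convex_closedBall (0 : V) (R + G)) (hKb z hz) (hTb z hz)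
    have hyb : y ∈ Metric.closedBall (0 : V) (R + G) :=
      (convex_closedBall (0 : V) (R + G)).segment_subset (hKb z hz) (hTb z hz) hy
    have hyd : ‖y - z‖ ≤ ‖T z - z‖ := by
      obtain ⟨t, ht, rfl⟩ := (segment_eq_image' ℝ z (T z)) ▸ hy
      rw [add_sub_cancel_left, norm_smul, Real.norm_of_nonneg ht.1]
      nlinarith [ht.2, norm_nonneg (T z - z)]
    have h1 := hLip z (hKb z hz) y hyb
    have h2 : (fderiv ℝ f y - fderiv ℝ f z) (T z - z) ≤
        ‖fderiv ℝ f y - fderiv ℝ f z‖ * ‖T z - z‖ :=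
      (le_abs_self _).trans ((fderiv ℝ f y - fderiv ℝ f z).le_opNorm (T z - z))
    have h3 : (fderiv ℝ f y - fderiv ℝ f z) (T z - z) =
        fderiv ℝ f y (T z - z) - fderiv ℝ f z (T z - z) := rfl
    have h4 : fderiv ℝ f z (T z - z) = - (η * ‖g z‖ ^ 2) := by
      simp only [T, sub_sub_cancel_left, map_neg, map_smul, hgg, smul_eq_mul]
    have h5 : ‖fderiv ℝ f y - fderiv ℝ f z‖ * ‖T z - z‖ ≤ L * ‖T z - z‖ * ‖T z - z‖ := by
      gcongr
      exact h1.trans (by gcongr)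
    have h6 : L * ‖T z - z‖ * ‖T z - z‖ = η / 2 * ‖g z‖ ^ 2 := by
      rw [hTn]
      linear_combination (η * ‖g z‖ ^ 2) * hηL
    linarith
  have hTK : ∀ z ∈ K, T z ∈ K := by
    intro z hz
    have := hdesc z hz
    have h2 : 0 ≤ η / 2 * ‖g z‖ ^ 2 := by positivity
    exact (by linarith : f (T z) ≤ f z).trans hz
  have hitK : ∀ z ∈ K, ∀ k, T^[k] z ∈ K := by
    intro z hz k
    induction k with
    | zero => exact hz
    | succ k ih => rw [Function.iterate_succ_apply']; exact hTK _ ih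
  have hgrad : ∀ z ∈ K, Tendsto (fun k => ‖g (T^[k] z)‖) atTop (𝓝 0) := by
    intro z hz
    have hanti : Antitone fun k => f (T^[k] z) := by
      refine antitone_nat_of_succ_le fun k => ?_
      rw [Function.iterate_succ_apply']
      have := hdesc _ (hitK z hz k)
      have h2 : 0 ≤ η / 2 * ‖g (T^[k] z)‖ ^ 2 := by positivity
      linarith
    obtain ⟨B, hB⟩ := (hKc.image hfc).bddBelow
    have hlim := tendsto_atTop_ciInf hanti
      ⟨B, by rintro _ ⟨k, rfl⟩; exact hB ⟨_, hitK z hz k, rfl⟩⟩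
    have hdiff := hlim.sub (hlim.comp (tendsto_add_atTop_nat 1))
    rw [sub_self] at hdiff
    have hsq : Tendsto (fun k => ‖g (T^[k] z)‖ ^ 2) atTop (𝓝 0) := by
      have h2 := hdiff.const_mul (2 / η)
      rw [mul_zero] at h2
      refine squeeze_zero (fun k => by positivity) (fun k => ?_) h2
      have := hdesc _ (hitK z hz k)
      simp only [Function.comp_apply, Function.iterate_succ_apply']
      rw [div_mul_eq_mul_div, le_div_iff₀ hη0]
      linarith
    have := hsq.sqrt
    simpa [Real.sqrt_sq] using this
  choose! ρ hρ c hc hball using fun Z (hZ : fderiv ℝ f Z = 0) =>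
    exists_ball_growth_of_hessian_pos hf hZ (hpos Z hZ)
  -- A trapping neighbourhood. Quadratic growth and the level bound `c ρ² / 8` confine its points to
  -- the ball of radius `ρ / 2`. As a step is no longer than the distance to `Z`, the next iterate
  -- stays in the ball of radius `ρ`, and the level does not increase.
  let N : V → Set V := fun Z => Metric.ball Z (ρ Z) ∩ {z | f z < f Z + c Z * ρ Z ^ 2 / 8}
  have hNo : ∀ Z, IsOpen (N Z) := fun Z =>
    Metric.isOpen_ball.inter (isOpen_lt hfc continuous_const)
  have hNself : ∀ Z, fderiv ℝ f Z = 0 → Z ∈ N Z := by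
    intro Z hZ
    have h1 := hρ Z hZ
    have h2 := hc Z hZ
    refine ⟨Metric.mem_ball_self h1, ?_⟩
    have : 0 < c Z * ρ Z ^ 2 / 8 := by positivity
    simp only [Set.mem_ofPred_eq]; linarith
  have hNinv : ∀ Z ∈ K, fderiv ℝ f Z = 0 → ∀ z ∈ K, z ∈ N Z → T z ∈ N Z := by
    intro Z hZK hZ z hzK hz
    have h1 := (hball Z hZ z hz.1).2
    have h2 : f z < f Z + c Z * ρ Z ^ 2 / 8 := hz.2
    have hcZ := hc Z hZ
    have hρZ := hρ Z hZ
    have h3 : ‖z - Z‖ < ρ Z / 2 := by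
      have : c Z * ‖z - Z‖ ^ 2 < c Z * (ρ Z / 2) ^ 2 := by nlinarith
      exact lt_of_pow_lt_pow_left₀ 2 (by positivity) (lt_of_mul_lt_mul_left this hcZ.le)
    have h4 : ‖g z‖ ≤ L * ‖z - Z‖ := by
      have := hLip Z (hKb Z hZK) z (hKb z hzK)
      rwa [hZ, sub_zero, ← hgn] at this
    have h5 : ‖T z - z‖ ≤ ‖z - Z‖ := by
      rw [hTn]
      have : η * ‖g z‖ ≤ η * (L * ‖z - Z‖) := by gcongr
      rw [← mul_assoc, hηL] at this
      linarith [norm_nonneg (z - Z)]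
    refine ⟨?_, ?_⟩
    · rw [Metric.mem_ball, dist_eq_norm]
      have : ‖T z - Z‖ ≤ ‖T z - z‖ + ‖z - Z‖ := norm_sub_le_norm_sub_add_norm_sub _ _ _
      linarith
    · have := hdesc z hzK
      have h6 : 0 ≤ η / 2 * ‖g z‖ ^ 2 := by positivity
      simp only [Set.mem_ofPred_eq]; linarith
  -- Within `K` this is the basin of attraction of `Z`. Once an iterate enters `N Z` it stays there,
  -- and the bound `c ‖z - Z‖ ≤ ‖∇f(z)‖` turns the decay of the gradient into convergence to `Z`.
  let O : V → Set V := fun Z => ⋃ k : ℕ, (T^[k]) ⁻¹' N Z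
  have hOo : ∀ Z, IsOpen (O Z) := fun Z =>
    isOpen_iUnion fun k => (hNo Z).preimage (hTc.iterate k)
  have hOlim : ∀ Z ∈ K, fderiv ℝ f Z = 0 → ∀ z ∈ K, z ∈ O Z →
      Tendsto (fun k => T^[k] z) atTop (𝓝 Z) := by
    intro Z hZK hZ z hzK hz
    obtain ⟨k, hk⟩ := Set.mem_iUnion.1 hz
    have hev : ∀ j ≥ k, T^[j] z ∈ N Z := by
      intro j hj
      induction j, hj using Nat.le_induction with
      | base => exact hk
      | succ j _ ih =>
        rw [Function.iterate_succ_apply']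
        exact hNinv Z hZK hZ _ (hitK z hzK j) ih
    rw [tendsto_iff_norm_sub_tendsto_zero]
    have h1 := (hgrad z hzK).div_const (c Z)
    rw [zero_div] at h1
    refine squeeze_zero' (Eventually.of_forall fun _ => norm_nonneg _) ?_ h1
    filter_upwards [eventually_ge_atTop k] with j hj
    have h2 := (hball Z hZ _ (hev j hj).1).1
    have h3 : fderiv ℝ f (T^[j] z) (T^[j] z - Z) ≤ ‖g (T^[j] z)‖ * ‖T^[j] z - Z‖ := by
      rw [hgn]
      exact (le_abs_self _).trans ((fderiv ℝ f (T^[j] z)).le_opNorm _)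
    rw [le_div_iff₀ (hc Z hZ)]
    rcases (norm_nonneg (T^[j] z - Z)).eq_or_lt with h0 | h0
    · rw [← h0, zero_mul]; exact norm_nonneg _
    · refine le_of_mul_le_mul_right ?_ h0
      linarith
  have hOcov : ∀ z ∈ K, ∃ Z ∈ K, fderiv ℝ f Z = 0 ∧ z ∈ O Z := by
    intro z hz
    obtain ⟨Z, hZK, φ, hφ, hlim⟩ := hKc.tendsto_subseq (hitK z hz)
    have h1 : Tendsto (fun k => ‖g (T^[φ k] z)‖) atTop (𝓝 ‖g Z‖) :=
      (hgc.norm.tendsto Z).comp hlim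
    have h2 := tendsto_nhds_unique h1 ((hgrad z hz).comp hφ.tendsto_atTop)
    have hZ : fderiv ℝ f Z = 0 := by
      rw [hgn, norm_eq_zero] at h2; exact h2
    obtain ⟨k, hk⟩ := (hlim.eventually ((hNo Z).mem_nhds (hNself Z hZ))).exists
    exact ⟨Z, hZK, hZ, Set.mem_iUnion.2 ⟨φ k, hk⟩⟩
  by_contra hXY
  have hY_mem : Y ∈ K := hM Y (right_mem_segment ℝ X Y)
  have hpre : IsPreconnected (segment ℝ X Y) := (convex_segment X Y).isPreconnected
  have hsub := isPreconnected_iff_subset_of_disjoint.1 hpre (O X)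
    (⋃ Z ∈ {Z | Z ∈ K ∧ fderiv ℝ f Z = 0 ∧ Z ≠ X}, O Z) (hOo X)
    (isOpen_biUnion fun Z _ => hOo Z) ?_ ?_
  · have hXO : X ∈ O X := Set.mem_iUnion.2 ⟨0, hNself X hX⟩
    have hYO : Y ∈ O Y := Set.mem_iUnion.2 ⟨0, hNself Y hY⟩
    rcases hsub with h | h
    · exact hXY (tendsto_nhds_unique (hOlim X hX_mem hX Y hY_mem (h (right_mem_segment ℝ X Y)))
        (hOlim Y hY_mem hY Y hY_mem hYO))
    · obtain ⟨Z, ⟨hZK, hZ, hZX⟩, hXZ⟩ := Set.mem_iUnion₂.1 (h (left_mem_segment ℝ X Y))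
      exact hZX (tendsto_nhds_unique (hOlim Z hZK hZ X hX_mem hXZ)
        (hOlim X hX_mem hX X hX_mem hXO))
  · intro z hz
    obtain ⟨Z, hZK, hZ, hzZ⟩ := hOcov z (hM z hz)
    rcases eq_or_ne Z X with rfl | hne
    · exact Or.inl hzZ
    · exact Or.inr (Set.mem_iUnion₂.2 ⟨Z, ⟨hZK, hZ, hne⟩, hzZ⟩)
  · refine Set.eq_empty_iff_forall_notMem.2 ?_
    rintro z ⟨hzs, hzX, hzZ⟩
    obtain ⟨Z, ⟨hZK, hZ, hZX⟩, hz'⟩ := Set.mem_iUnion₂.1 hzZ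
    exact hZX (tendsto_nhds_unique (hOlim Z hZK hZ z (hM z hzs) hz')
      (hOlim X hX_mem hX z (hM z hzs) hzX))

end UniqueCriticalPoint

end TwistMap

namespace TwistMap

variable {d : ℕ}

/-! ### The lattice -/

@[simp] theorem latticeVec_zero : latticeVec (0 : Fin d → ℤ) = 0 := by
  ext i; simp [latticeVec]

theorem latticeVec_add (r s : Fin d → ℤ) : latticeVec (r + s) = latticeVec r + latticeVec s := by
  ext i; simp [latticeVec]

theorem latticeVec_neg (r : Fin d → ℤ) : latticeVec (-r) = -latticeVec r := by
  ext i; simp [latticeVec]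

theorem latticeVec_sub (r s : Fin d → ℤ) : latticeVec (r - s) = latticeVec r - latticeVec s := by
  ext i; simp [latticeVec]

theorem latticeVec_nsmul (k : ℕ) (r : Fin d → ℤ) : latticeVec (k • r) = k • latticeVec r := by
  ext i; simp [latticeVec]

theorem exists_norm_sub_latticeVec_le (x : E d) :
    ∃ r : Fin d → ℤ, ‖x - latticeVec r‖ ≤ Real.sqrt d := by
  refine ⟨fun i => ⌊x i⌋, ?_⟩
  rw [EuclideanSpace.norm_eq]
  refine Real.sqrt_le_sqrt ?_
  calc ∑ i, ‖(x - latticeVec fun i => ⌊x i⌋) i‖ ^ 2 ≤ ∑ _i : Fin d, (1 : ℝ) := by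
        refine Finset.sum_le_sum fun i _ => ?_
        have h1 : (x - latticeVec fun i => ⌊x i⌋) i = Int.fract (x i) := rfl
        rw [h1, Real.norm_of_nonneg (Int.fract_nonneg _)]
        exact pow_le_one₀ (Int.fract_nonneg _) (Int.fract_lt_one _).le
    _ = d := by simp

theorem exists_bound_of_periodic {F : Type*} [NormedAddCommGroup F] {g : E d → F}
    (hg : Continuous g) (hp : ∀ (r : Fin d → ℤ) x, g (x + latticeVec r) = g x) :
    ∃ C, ∀ x, ‖g x‖ ≤ C := by
  obtain ⟨C, hC⟩ := ((isCompact_closedBall (0 : E d) (Real.sqrt d)).image hg.norm).bddAbove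
  refine ⟨C, fun x => ?_⟩
  obtain ⟨r, hr⟩ := exists_norm_sub_latticeVec_le x
  have := hp r (x - latticeVec r)
  rw [sub_add_cancel] at this
  rw [this]
  exact hC ⟨_, by simpa using hr, rfl⟩

/-! ### Coercive periodic costs -/

/-- A continuous cost on `ℝ^d × ℝ^d`, invariant under the diagonal action of `ℤ^d`, which tends to
infinity with the distance between its arguments. -/
structure PeriodicCost (L : E d × E d → ℝ) : Prop where
  continuous : Continuous L
  periodic : ∀ (r : Fin d → ℤ) x y, L (x + latticeVec r, y + latticeVec r) = L (x, y)
  coercive : ∀ M, ∃ R, ∀ x y, L (x, y) ≤ M → ‖x - y‖ ≤ R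

namespace PeriodicCost

variable {L : E d × E d → ℝ} (hL : PeriodicCost L)
include hL

theorem exists_abs_le (R : ℝ) : ∃ C, ∀ x y, ‖x - y‖ ≤ R → |L (x, y)| ≤ C := by
  obtain ⟨C, hC⟩ := (((isCompact_closedBall (0 : E d) (Real.sqrt d)).prod
    (isCompact_closedBall (0 : E d) (Real.sqrt d + R))).image hL.continuous.abs).bddAbove
  refine ⟨C, fun x y hxy => ?_⟩
  obtain ⟨r, hr⟩ := exists_norm_sub_latticeVec_le x
  have := hL.periodic r (x - latticeVec r) (y - latticeVec r)
  rw [sub_add_cancel, sub_add_cancel] at this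
  rw [this]
  refine hC ⟨_, ⟨by simpa using hr, ?_⟩, rfl⟩
  rw [mem_closedBall_zero_iff]
  calc ‖y - latticeVec r‖ = ‖(x - latticeVec r) - (x - y)‖ := by congr 1; abel
    _ ≤ _ := (norm_sub_le _ _).trans (add_le_add hr hxy)

theorem exists_lower_bound : ∃ C, 0 ≤ C ∧ ∀ z, -C ≤ L z := by
  obtain ⟨R, hR⟩ := hL.coercive 0
  obtain ⟨C, hC⟩ := hL.exists_abs_le R
  refine ⟨max C 0, le_max_right _ _, fun ⟨x, y⟩ => ?_⟩
  rcases le_total (L (x, y)) 0 with h | h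
  · have := neg_le_of_abs_le (hC x y (hR x y h))
    linarith [le_max_left C 0]
  · linarith [le_max_right C 0]

/-- Pairs at bounded distance form a compact set modulo the diagonal lattice action. -/
theorem uniformContinuous_of_bounded (R : ℝ) {ε : ℝ} (hε : 0 < ε) : ∃ δ > 0, ∀ x y x' y',
    ‖x - y‖ ≤ R → ‖x' - x‖ < δ → ‖y' - y‖ < δ → |L (x', y') - L (x, y)| < ε := by
  have hK : IsCompact ((Metric.closedBall (0 : E d) (Real.sqrt d + 1)) ×ˢ
    (Metric.closedBall (0 : E d) (Real.sqrt d + R + 1))) :=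
    (isCompact_closedBall _ _).prod (isCompact_closedBall _ _)
  obtain ⟨δ, hδ, h⟩ := Metric.uniformContinuousOn_iff.1
    (hK.uniformContinuousOn_of_continuous hL.continuous.continuousOn) ε hε
  refine ⟨min δ 1, lt_min hδ one_pos, fun x y x' y' hxy hx hy => ?_⟩
  obtain ⟨r, hr⟩ := exists_norm_sub_latticeVec_le x
  have h1 := hL.periodic r (x - latticeVec r) (y - latticeVec r)
  have h2 := hL.periodic r (x' - latticeVec r) (y' - latticeVec r)
  simp only [sub_add_cancel] at h1 h2
  rw [h1, h2, ← Real.dist_eq]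
  have hy0 : ‖y - latticeVec r‖ ≤ Real.sqrt d + R := by
    calc ‖y - latticeVec r‖ = ‖(x - latticeVec r) - (x - y)‖ := by congr 1; abel
      _ ≤ _ := (norm_sub_le _ _).trans (add_le_add hr hxy)
  have hx1 : ‖x' - latticeVec r‖ ≤ Real.sqrt d + 1 := by
    calc ‖x' - latticeVec r‖ = ‖(x - latticeVec r) + (x' - x)‖ := by congr 1; abel
      _ ≤ _ := (norm_add_le _ _).trans (add_le_add hr (hx.le.trans (min_le_right _ _)))
  have hy1 : ‖y' - latticeVec r‖ ≤ Real.sqrt d + R + 1 := by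
    calc ‖y' - latticeVec r‖ = ‖(y - latticeVec r) + (y' - y)‖ := by congr 1; abel
      _ ≤ _ := (norm_add_le _ _).trans (add_le_add hy0 (hy.le.trans (min_le_right _ _)))
  refine h _ ⟨?_, ?_⟩ _ ⟨?_, ?_⟩ ?_
  · simpa using hx1
  · simpa using hy1
  · simpa using hr.trans (by linarith)
  · simpa using hy0.trans (by linarith)
  · rw [Prod.dist_eq, dist_eq_norm, dist_eq_norm]
    simp only [sub_sub_sub_cancel_right]
    exact max_lt (hx.trans_le (min_le_left _ _)) (hy.trans_le (min_le_left _ _))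

end PeriodicCost

/-! ### Growth of generating functions -/

namespace GeneratingFunction

variable (S : GeneratingFunction d)

theorem differentiable : Differentiable ℝ S.toFun := S.contDiff.differentiable (by norm_num)

theorem contDiff_fderiv : ContDiff ℝ 1 (fderiv ℝ S.toFun) := S.contDiff.fderiv_right (by norm_num)

theorem fderiv_periodic (r : Fin d → ℤ) (x y : E d) :
    fderiv ℝ S.toFun (x + latticeVec r, y + latticeVec r) = fderiv ℝ S.toFun (x, y) := by
  have h : (fun z : E d × E d => S.toFun (z + (latticeVec r, latticeVec r))) = S.toFun :=
    funext fun z => S.periodic r z.1 z.2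
  have h2 := fderiv_comp_add_right (𝕜 := ℝ) (f := S.toFun) (x := (x, y))
    (latticeVec r, latticeVec r)
  rw [h] at h2
  exact h2.symm

theorem fderiv_apply (x y ξ ζ : E d) :
    fderiv ℝ S.toFun (x, y) (ξ, ζ) = S.d₁ x y ξ + S.d₂ x y ζ := by
  simp [d₁, d₂, ← map_add]

theorem d₁_periodic (r : Fin d → ℤ) (x y : E d) :
    S.d₁ (x + latticeVec r) (y + latticeVec r) = S.d₁ x y := by
  simp only [d₁, S.fderiv_periodic]

/-- Integrate the twist inequality over the triangle between the diagonal and `(x, y)`: once in the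
first variable to bound `∂₂S` from below, once in the second to bound `S`. On the diagonal, `S` and
its derivative are bounded by periodicity. -/
theorem exists_quadratic_lower_bound : ∃ a > 0, ∃ b ≥ 0, ∀ x y,
    a * ‖x - y‖ ^ 2 - b * (1 + ‖x - y‖) ≤ S.toFun (x, y) := by
  obtain ⟨A, hA, htw⟩ := S.twist
  obtain ⟨b₀, hb₀⟩ := exists_bound_of_periodic (g := fun x : E d => S.toFun (x, x))
    (S.contDiff.continuous.comp (by fun_prop)) fun r x => S.periodic r x x
  obtain ⟨b₁, hb₁⟩ := exists_bound_of_periodic (g := fun x : E d => fderiv ℝ S.toFun (x, x))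
    (S.contDiff_fderiv.continuous.comp (by fun_prop)) fun r x => S.fderiv_periodic r x x
  have hb₀' : 0 ≤ b₀ := (norm_nonneg _).trans (hb₀ 0)
  have hb₁' : 0 ≤ b₁ := (norm_nonneg _).trans (hb₁ 0)
  refine ⟨A / 2, by positivity, max b₀ b₁, le_max_of_le_left hb₀', fun x y => ?_⟩
  set w := y - x with hw
  have hpt : ∀ t : ℝ, HasDerivAt (fun t : ℝ => x + t • w) w t := fun t => by
    simpa using ((hasDerivAt_id t).smul_const w).const_add x
  have hinner : ∀ t : ℝ, 0 ≤ t → -(b₁ * ‖w‖) + A * ‖w‖ ^ 2 * t ≤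
      fderiv ℝ S.toFun (x, x + t • w) (0, w) := by
    intro t ht
    let ψ : ℝ → ℝ := fun s => fderiv ℝ S.toFun (x + s • w, x + t • w) (0, w) + A * ‖w‖ ^ 2 * s
    have hψ : ∀ s, HasDerivAt ψ
        (fderiv ℝ (fderiv ℝ S.toFun) (x + s • w, x + t • w) (w, 0) (0, w) + A * ‖w‖ ^ 2) s := by
      intro s
      have h1 := ((hpt s).prodMk (hasDerivAt_const s (x + t • w)))
      have h2 := ((S.contDiff_fderiv.differentiable (by norm_num))
        (x + s • w, x + t • w)).hasFDerivAt.comp_hasDerivAt s h1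
      have h3 := ((ContinuousLinearMap.apply ℝ ℝ ((0, w) : E d × E d)).hasFDerivAt.comp_hasDerivAt
        s h2)
      exact h3.add (by simpa using (hasDerivAt_id s).const_mul (A * ‖w‖ ^ 2))
    have hanti : Antitone ψ := antitone_of_deriv_nonpos (fun s => (hψ s).differentiableAt)
      fun s => by
        rw [(hψ s).deriv]
        linarith [htw (x + s • w) (x + t • w) w]
    have h := hanti ht
    simp only [ψ, zero_smul, add_zero, mul_zero] at h
    have h2 : -(b₁ * ‖w‖) ≤ fderiv ℝ S.toFun (x + t • w, x + t • w) (0, w) := by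
      refine neg_le_of_abs_le (((fderiv ℝ S.toFun (x + t • w, x + t • w)).le_opNorm _).trans ?_)
      have : ‖((0, w) : E d × E d)‖ = ‖w‖ := by simp [Prod.norm_def]
      rw [this]
      exact mul_le_mul_of_nonneg_right (hb₁ _) (norm_nonneg _)
    linarith
  let φ : ℝ → ℝ := fun t => S.toFun (x, x + t • w) + b₁ * ‖w‖ * t - A / 2 * ‖w‖ ^ 2 * t ^ 2
  have hφ : ∀ t, HasDerivAt φ
      (fderiv ℝ S.toFun (x, x + t • w) (0, w) + b₁ * ‖w‖ - A * ‖w‖ ^ 2 * t) t := by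
    intro t
    have h1 := (hasDerivAt_const t x).prodMk (hpt t)
    have h2 := (S.differentiable (x, x + t • w)).hasFDerivAt.comp_hasDerivAt t h1
    have h3 := ((hasDerivAt_pow 2 t).const_mul (A / 2 * ‖w‖ ^ 2))
    have h4 : HasDerivAt (fun t : ℝ => b₁ * ‖w‖ * t) (b₁ * ‖w‖) t := by
      simpa using (hasDerivAt_id t).const_mul (b₁ * ‖w‖)
    refine ((h2.add h4).sub h3).congr_deriv ?_
    simp; ring
  have hmono : MonotoneOn φ (Set.Icc 0 1) := by
    refine monotoneOn_of_deriv_nonneg (convex_Icc 0 1)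
      (fun t _ => (hφ t).continuousAt.continuousWithinAt)
      (fun t _ => (hφ t).differentiableAt.differentiableWithinAt) fun t ht => ?_
    rw [interior_Icc] at ht
    rw [(hφ t).deriv]
    linarith [hinner t ht.1.le]
  have h := hmono (by simp) (by simp) zero_le_one
  simp only [φ, zero_smul, add_zero, one_smul, mul_zero, hw, add_sub_cancel] at h
  have h0 : -b₀ ≤ S.toFun (x, x) := neg_le_of_abs_le (hb₀ x)
  rw [norm_sub_rev y x] at h
  have h1 : b₀ + b₁ * ‖x - y‖ ≤ max b₀ b₁ * (1 + ‖x - y‖) := by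
    rw [mul_add, mul_one]
    gcongr
    · exact le_max_left _ _
    · exact le_max_right _ _
  norm_num at h
  linarith

end GeneratingFunction

theorem IsPrimitive.exists_lipschitz {u : E d → ℝ} {c : H1 d} (hu : IsPrimitive u c) :
    ∃ K ≥ 0, ∀ x y, |u x - u y| ≤ K * ‖x - y‖ := by
  obtain ⟨hs, η, -, hη⟩ := hu
  obtain ⟨K, hK⟩ := exists_bound_of_periodic η.2.1.continuous η.2.2.1
  refine ⟨K, (norm_nonneg _).trans (hK 0), fun x y => ?_⟩
  exact convex_univ.norm_image_sub_le_of_norm_fderiv_le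
    (fun z _ => hs.differentiable (by simp) z) (fun z _ => by rw [hη]; exact hK z)
    (Set.mem_univ y) (Set.mem_univ x)

theorem IsPrimitive.add_latticeVec {u : E d → ℝ} {c : H1 d} (hu : IsPrimitive u c)
    (r : Fin d → ℤ) (x : E d) : u (x + latticeVec r) - u x = u (latticeVec r) - u 0 := by
  obtain ⟨hs, η, -, hη⟩ := hu
  have hd : Differentiable ℝ u := hs.differentiable (by simp)
  have hd' : Differentiable ℝ fun x => u (x + latticeVec r) := hd.comp (by fun_prop)
  have h := is_const_of_fderiv_eq_zero (𝕜 := ℝ) (f := fun x => u (x + latticeVec r) - u x)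
    (hd'.sub hd) (fun z => ?_) x 0
  · simpa using h
  · rw [fderiv_fun_sub (hd' z) (hd z), fderiv_comp_add_right, hη, η.2.2.1, sub_self]

theorem GeneratingFunction.periodicCost_shift (S : GeneratingFunction d) {u : E d → ℝ} {c : H1 d}
    (hu : IsPrimitive u c) : PeriodicCost (shift S.toFun u) := by
  refine ⟨?_, fun r x y => ?_, fun M => ?_⟩
  · have := hu.1.continuous
    have := S.contDiff.continuous
    unfold shift
    fun_prop
  · have h1 := hu.add_latticeVec r x
    have h2 := hu.add_latticeVec r y
    simp only [shift, S.periodic]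
    linarith
  · obtain ⟨a, ha, b, hb, h⟩ := S.exists_quadratic_lower_bound
    obtain ⟨K, hK, hu'⟩ := hu.exists_lipschitz
    -- Beyond this radius `t > 1` and `a (t - 1) > b + K + |M|`, so `a t² - b (1 + t) - K t` exceeds
    -- `M`.
    refine ⟨(b + K + |M|) / a + 1 + 1, fun x y hxy => ?_⟩
    have h1 := h x y
    have h2 := neg_le_of_abs_le (hu' x y)
    simp only [shift] at hxy
    set t := ‖x - y‖
    have ht : 0 ≤ t := norm_nonneg _
    by_contra! hcon
    have h3 : (b + K + |M|) < a * (t - 1) := by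
      have : (b + K + |M|) / a < t - 1 := by linarith
      rw [div_lt_iff₀ ha] at this
      linarith
    have h4 : 1 < t := by
      have : 0 ≤ (b + K + |M|) / a := by positivity
      linarith
    have h5 := le_abs_self M
    nlinarith [abs_nonneg M]

theorem GeneratingFunction.periodicCost (S : GeneratingFunction d) : PeriodicCost S.toFun := by
  have h : IsPrimitive (fun _ : E d => (0 : ℝ)) (0 : H1 d) := by
    refine ⟨contDiff_const, 0, rfl, ?_⟩
    ext1 x
    simp
  have h2 := S.periodicCost_shift h
  have h3 : shift S.toFun (fun _ => 0) = S.toFun := by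
    funext z; simp [shift]
  rwa [h3] at h2

end TwistMap

namespace TwistMap

variable {d : ℕ}

/-! ### Derivatives of the action -/

/-- The first variation of the action along the variation `ξ`. -/
noncomputable def actionDeriv (f : E d × E d → ℝ) (x ξ : ℕ → E d) (n : ℕ) : ℝ :=
  ∑ k ∈ Finset.range n, fderiv ℝ f (x k, x (k + 1)) (ξ k, ξ (k + 1))

/-- The second variation of the action. -/
noncomputable def actionHess (f : E d × E d → ℝ) (x ξ ζ : ℕ → E d) (n : ℕ) : ℝ :=
  ∑ k ∈ Finset.range n,
    fderiv ℝ (fderiv ℝ f) (x k, x (k + 1)) (ξ k, ξ (k + 1)) (ζ k, ζ (k + 1))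

theorem sum_apply_single (a : ℕ → E d × E d →L[ℝ] ℝ) {k n : ℕ} (hk : k + 1 < n) (v : E d) :
    ∑ j ∈ Finset.range n, a j ((Pi.single (k + 1) v : ℕ → E d) j,
      (Pi.single (k + 1) v : ℕ → E d) (j + 1)) = a k (0, v) + a (k + 1) (v, 0) := by
  rw [Finset.sum_eq_add_of_mem k (k + 1) (by simp; omega) (by simpa using hk) (by omega)]
  · rw [Pi.single_eq_of_ne (by omega), Pi.single_eq_same,
      Pi.single_eq_of_ne (i := k + 1) (i' := k + 1 + 1) (by omega)]
  · rintro j - ⟨h1, h2⟩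
    rw [Pi.single_eq_of_ne h2, Pi.single_eq_of_ne (by omega), Prod.mk_zero_zero, map_zero]

namespace GeneratingFunction

variable (S : GeneratingFunction d)

/-- A configuration is stationary on `[0, n]` if the first variation of the action vanishes along
the variations which fix the endpoints. -/
def IsStationary (x : ℕ → E d) (n : ℕ) : Prop :=
  ∀ ξ : ℕ → E d, ξ 0 = 0 → ξ n = 0 → actionDeriv S.toFun x ξ n = 0

variable {S} in
theorem IsStationary.euler_lagrange {x : ℕ → E d} {n : ℕ} (h : S.IsStationary x n) {k : ℕ}
    (hk : k + 1 < n) : S.d₂ (x k) (x (k + 1)) + S.d₁ (x (k + 1)) (x (k + 2)) = 0 := by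
  ext v
  have h1 := h (Pi.single (k + 1) v) (Pi.single_eq_of_ne (by omega) _)
    (Pi.single_eq_of_ne (by omega) _)
  rw [actionDeriv, sum_apply_single (fun k => fderiv ℝ S.toFun (x k, x (k + 1))) hk] at h1
  simpa [fderiv_apply] using h1

/-! ### Derivative of the twist map -/

/-- The derivative of `legendre`. -/
noncomputable def legendreDeriv (z : E d × E d) : E d × E d →L[ℝ] E d × Dual d :=
  (ContinuousLinearMap.fst ℝ (E d) (E d)).prod
    (-(((ContinuousLinearMap.compL ℝ (E d) (E d × E d) ℝ).flip
      (ContinuousLinearMap.inl ℝ (E d) (E d))).comp (fderiv ℝ (fderiv ℝ S.toFun) z)))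

/-- The derivative of `legendre'`. -/
noncomputable def legendreDeriv' (z : E d × E d) : E d × E d →L[ℝ] E d × Dual d :=
  (ContinuousLinearMap.snd ℝ (E d) (E d)).prod
    (((ContinuousLinearMap.compL ℝ (E d) (E d × E d) ℝ).flip
      (ContinuousLinearMap.inr ℝ (E d) (E d))).comp (fderiv ℝ (fderiv ℝ S.toFun) z))

theorem legendreDeriv_apply (z w : E d × E d) : S.legendreDeriv z w =
    (w.1, -(fderiv ℝ (fderiv ℝ S.toFun) z w).comp (ContinuousLinearMap.inl ℝ (E d) (E d))) := rfl

theorem legendreDeriv'_apply (z w : E d × E d) : S.legendreDeriv' z w =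
    (w.2, (fderiv ℝ (fderiv ℝ S.toFun) z w).comp (ContinuousLinearMap.inr ℝ (E d) (E d))) := rfl

theorem hasStrictFDerivAt_legendre (z : E d × E d) :
    HasStrictFDerivAt S.legendre (S.legendreDeriv z) z := by
  have h1 : HasStrictFDerivAt (fderiv ℝ S.toFun) (fderiv ℝ (fderiv ℝ S.toFun) z) z :=
    S.contDiff_fderiv.contDiffAt.hasStrictFDerivAt (by norm_num)
  have h2 := ((ContinuousLinearMap.compL ℝ (E d) (E d × E d) ℝ).flip
      (ContinuousLinearMap.inl ℝ (E d) (E d))).hasStrictFDerivAt.comp z h1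
  exact hasStrictFDerivAt_fst.prodMk h2.neg

theorem hasStrictFDerivAt_legendre' (z : E d × E d) :
    HasStrictFDerivAt S.legendre' (S.legendreDeriv' z) z := by
  have h1 : HasStrictFDerivAt (fderiv ℝ S.toFun) (fderiv ℝ (fderiv ℝ S.toFun) z) z :=
    S.contDiff_fderiv.contDiffAt.hasStrictFDerivAt (by norm_num)
  have h2 := ((ContinuousLinearMap.compL ℝ (E d) (E d × E d) ℝ).flip
      (ContinuousLinearMap.inr ℝ (E d) (E d))).hasStrictFDerivAt.comp z h1
  exact hasStrictFDerivAt_snd.prodMk h2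

theorem eq_zero_of_hess_eq_zero {z : E d × E d} {ξ : E d}
    (h : fderiv ℝ (fderiv ℝ S.toFun) z (ξ, 0) (0, ξ) = 0) : ξ = 0 := by
  obtain ⟨A, hA, htw⟩ := S.twist
  have h1 := htw z.1 z.2 ξ
  rw [h] at h1
  have : ‖ξ‖ ^ 2 ≤ 0 := by nlinarith [sq_nonneg ‖ξ‖]
  simpa using this

theorem hess_symm (z v w : E d × E d) : fderiv ℝ (fderiv ℝ S.toFun) z v w =
    fderiv ℝ (fderiv ℝ S.toFun) z w v :=
  (S.contDiff.contDiffAt.isSymmSndFDerivAt (by simp)).eq v w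

/-- A kernel vector has the form `(0, ζ)`. Evaluating its second component at `ζ` gives the twist
form, which is definite. -/
theorem legendreDeriv_injective (z : E d × E d) : Function.Injective (S.legendreDeriv z) := by
  rw [injective_iff_map_eq_zero]
  rintro ⟨ξ, ζ⟩ h
  rw [legendreDeriv_apply, Prod.mk_eq_zero, neg_eq_zero] at h
  obtain ⟨rfl, h⟩ := h
  have h1 := DFunLike.congr_fun h ζ
  simp only [ContinuousLinearMap.comp_apply, ContinuousLinearMap.inl_apply, zero_apply] at h1
  rw [hess_symm] at h1
  rw [S.eq_zero_of_hess_eq_zero h1, Prod.mk_zero_zero]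

theorem legendreDeriv'_injective (z : E d × E d) : Function.Injective (S.legendreDeriv' z) := by
  rw [injective_iff_map_eq_zero]
  rintro ⟨ξ, ζ⟩ h
  rw [legendreDeriv'_apply, Prod.mk_eq_zero] at h
  obtain ⟨rfl, h⟩ := h
  have h1 := DFunLike.congr_fun h ξ
  simp only [ContinuousLinearMap.comp_apply, ContinuousLinearMap.inr_apply, zero_apply] at h1
  rw [S.eq_zero_of_hess_eq_zero h1, Prod.mk_zero_zero]

/-- The derivative of `legendre` as an isomorphism. -/
noncomputable def legendreDerivEquiv (z : E d × E d) : (E d × E d) ≃L[ℝ] E d × Dual d :=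
  (LinearEquiv.ofInjectiveOfFinrankEq (S.legendreDeriv z : E d × E d →ₗ[ℝ] E d × Dual d)
    (S.legendreDeriv_injective z) (by
      have hdim : Module.finrank ℝ (E d) = Module.finrank ℝ (Dual d) :=
        (InnerProductSpace.toDual ℝ (E d)).toLinearEquiv.finrank_eq
      rw [Module.finrank_prod, Module.finrank_prod, hdim])).toContinuousLinearEquiv

theorem legendreDerivEquiv_apply (z w : E d × E d) :
    S.legendreDerivEquiv z w = S.legendreDeriv z w := rfl

theorem continuous_legendre_symm : Continuous S.legendre.symm := by
  have ho : IsOpenMap S.legendre := isOpenMap_iff_nhds_le.2 fun z =>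
    (HasStrictFDerivAt.map_nhds_eq_of_equiv (f' := S.legendreDerivEquiv z)
      (S.hasStrictFDerivAt_legendre z)).ge
  exact S.legendre.continuous_symm_iff.2 ho

/-- The derivative of the twist map at `legendre z`. -/
noncomputable def twistDeriv (z : E d × E d) : E d × Dual d →L[ℝ] E d × Dual d :=
  (S.legendreDeriv' z).comp
    ((S.legendreDerivEquiv z).symm : E d × Dual d →L[ℝ] E d × E d)

theorem hasFDerivAt_twistMap (z : E d × E d) :
    HasFDerivAt S.twistMap (S.twistDeriv z) (S.legendre z) := by
  have h1 : HasFDerivAt S.legendre.symm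
      ((S.legendreDerivEquiv z).symm : E d × Dual d →L[ℝ] E d × E d) (S.legendre z) := by
    refine HasFDerivAt.of_local_left_inverse S.continuous_legendre_symm.continuousAt ?_
      (Eventually.of_forall S.legendre.apply_symm_apply)
    rw [Equiv.symm_apply_apply]
    exact (S.hasStrictFDerivAt_legendre z).hasFDerivAt
  have h2 : HasFDerivAt S.legendre' (S.legendreDeriv' z) (S.legendre.symm (S.legendre z)) := by
    rw [Equiv.symm_apply_apply]
    exact (S.hasStrictFDerivAt_legendre' z).hasFDerivAt
  exact h2.comp _ h1

theorem twistDeriv_injective (z : E d × E d) : Function.Injective (S.twistDeriv z) :=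
  (S.legendreDeriv'_injective z).comp (S.legendreDerivEquiv z).symm.injective

theorem twistDeriv_legendreDeriv (z w : E d × E d) :
    S.twistDeriv z (S.legendreDeriv z w) = S.legendreDeriv' z w := by
  rw [← legendreDerivEquiv_apply]
  simp [twistDeriv]

theorem continuous_twistMap : Continuous S.twistMap := by
  refine continuous_iff_continuousAt.2 fun w => ?_
  obtain ⟨z, rfl⟩ := S.legendre.surjective w
  exact (S.hasFDerivAt_twistMap z).continuousAt

/-- The projection to `ℝ^d` of the orbit of `z` under the twist map. -/
noncomputable def orbit (z : E d × Dual d) (k : ℕ) : E d := (S.twistMap^[k] z).1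

theorem continuous_orbit (k : ℕ) : Continuous fun z => S.orbit z k :=
  continuous_fst.comp (S.continuous_twistMap.iterate k)

theorem iterate_twistMap_eq_legendre (z : E d × Dual d) (k : ℕ) :
    S.twistMap^[k] z = S.legendre (S.orbit z k, S.orbit z (k + 1)) := by
  have h : S.twistMap (S.twistMap^[k] z) = S.twistMap^[k + 1] z :=
    (Function.iterate_succ_apply' _ _ _).symm
  exact Prod.ext rfl ((S.twistMap_eq_iff _ _ _ _).1 h).1

/-- The Euler-Lagrange equation says that the momentum `∂₂S` arriving at a point equals the momentum
`-∂₁S` leaving it, which is the recursion defining the twist map. -/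
theorem orbit_eq_of_euler_lagrange {x : ℕ → E d} {n : ℕ}
    (h : ∀ k, k + 1 < n → S.d₂ (x k) (x (k + 1)) + S.d₁ (x (k + 1)) (x (k + 2)) = 0) {k : ℕ}
    (hk : k ≤ n) : S.orbit (S.legendre (x 0, x 1)) k = x k := by
  have key : ∀ k, k < n →
      S.twistMap^[k] (S.legendre (x 0, x 1)) = S.legendre (x k, x (k + 1)) := by
    intro k
    induction k with
    | zero => intro _; rfl
    | succ k ih =>
      intro hk
      rw [Function.iterate_succ_apply', ih (by omega)]
      refine (S.twistMap_eq_iff _ _ _ _).2 ⟨rfl, ?_⟩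
      exact (eq_neg_of_add_eq_zero_left (h k hk)).symm
  -- The last point has no outgoing edge, so it is read off as the position reached from the last
  -- edge.
  rcases hk.eq_or_lt with rfl | hk
  · cases k with
    | zero => rfl
    | succ k =>
      rw [orbit, Function.iterate_succ_apply', key k (by omega)]
      exact congrArg Prod.fst ((S.twistMap_eq_iff _ _ _ _).2 ⟨rfl, rfl⟩)
  · rw [orbit, key k hk]; rfl

theorem exists_hasFDerivAt_iterate (z : E d × Dual d) (k : ℕ) :
    ∃ T : E d × Dual d →L[ℝ] E d × Dual d, HasFDerivAt S.twistMap^[k] T z ∧ Function.Injective T := by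
  induction k with
  | zero => exact ⟨_, hasFDerivAt_id z, fun _ _ h => h⟩
  | succ k ih =>
    obtain ⟨T, hT, hi⟩ := ih
    have h1 := S.hasFDerivAt_twistMap (S.orbit z k, S.orbit z (k + 1))
    rw [← S.iterate_twistMap_eq_legendre] at h1
    rw [Function.iterate_succ']
    exact ⟨_, h1.comp z hT, (S.twistDeriv_injective _).comp hi⟩

theorem fderiv_iterate_succ_apply (z v : E d × Dual d) (k : ℕ) :
    fderiv ℝ S.twistMap^[k + 1] z v =
      S.twistDeriv (S.orbit z k, S.orbit z (k + 1)) (fderiv ℝ S.twistMap^[k] z v) := by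
  obtain ⟨T, hT, -⟩ := S.exists_hasFDerivAt_iterate z k
  have h1 := S.hasFDerivAt_twistMap (S.orbit z k, S.orbit z (k + 1))
  rw [← S.iterate_twistMap_eq_legendre] at h1
  rw [Function.iterate_succ', (h1.comp z hT).fderiv, hT.fderiv]
  rfl

variable {S}

/-- Without conjugate points, a Jacobi field which vanishes at two distinct times is zero. -/
theorem WithoutConjugatePoints.jacobi_eq_zero (hS : S.WithoutConjugatePoints)
    (z : E d × Dual d) {n : ℕ} {ξ : ℕ → E d} (h0 : ξ 0 = 0) (hn : ξ n = 0)
    (hJ : ∀ k, k + 1 < n → ∀ v,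
      fderiv ℝ (fderiv ℝ S.toFun) (S.orbit z k, S.orbit z (k + 1)) (ξ k, ξ (k + 1)) (0, v) +
      fderiv ℝ (fderiv ℝ S.toFun) (S.orbit z (k + 1), S.orbit z (k + 2))
        (ξ (k + 1), ξ (k + 2)) (v, 0) = 0) {k : ℕ} (hk : k ≤ n) : ξ k = 0 := by
  rcases Nat.eq_zero_or_pos n with rfl | hpos
  · rwa [Nat.le_zero.1 hk]
  -- The tangent vector at `z` that generates the Jacobi field `ξ`. It is vertical since `ξ 0 = 0`,
  -- and its image under `DF^n` is vertical since `ξ n = 0`.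
  set η := S.legendreDeriv (S.orbit z 0, S.orbit z 1) (ξ 0, ξ 1) with hη
  have hJ' : ∀ k, k + 1 < n →
      S.legendreDeriv' (S.orbit z k, S.orbit z (k + 1)) (ξ k, ξ (k + 1)) =
      S.legendreDeriv (S.orbit z (k + 1), S.orbit z (k + 2)) (ξ (k + 1), ξ (k + 2)) := by
    intro k hk
    rw [legendreDeriv_apply, legendreDeriv'_apply]
    refine Prod.ext rfl ?_
    ext v
    exact eq_neg_of_add_eq_zero_left (hJ k hk v)
  have hD : ∀ k, k < n → fderiv ℝ S.twistMap^[k] z η =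
      S.legendreDeriv (S.orbit z k, S.orbit z (k + 1)) (ξ k, ξ (k + 1)) := by
    intro k
    induction k with
    | zero =>
      intro _
      rw [Function.iterate_zero, fderiv_id]
      rfl
    | succ k ih =>
      intro hk
      rw [fderiv_iterate_succ_apply, ih (by omega), twistDeriv_legendreDeriv, hJ' k hk]
  have hDn : (fderiv ℝ S.twistMap^[n] z η).1 = 0 := by
    obtain ⟨m, rfl⟩ := Nat.exists_eq_succ_of_ne_zero hpos.ne'
    rw [Nat.succ_eq_add_one, fderiv_iterate_succ_apply, hD m (by omega), twistDeriv_legendreDeriv]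
    exact hn
  have hη1 : η.1 = 0 := h0
  have hinf := hS z n (by exact_mod_cast hpos.ne')
  rw [zpow_natCast, Equiv.Perm.coe_pow] at hinf
  have hmem : fderiv ℝ S.twistMap^[n] z η ∈ vertical d ⊓ (vertical d).map
      (fderiv ℝ S.twistMap^[n] z : E d × Dual d →ₗ[ℝ] E d × Dual d) :=
    ⟨hDn, ⟨η, hη1, rfl⟩⟩
  rw [hinf, Submodule.mem_bot] at hmem
  have hη0 : η = 0 := by
    obtain ⟨T, hT, hi⟩ := S.exists_hasFDerivAt_iterate z n
    rw [hT.fderiv] at hmem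
    exact hi (hmem.trans (map_zero T).symm)
  rcases hk.eq_or_lt with rfl | hk
  · exact hn
  · have h1 := hD k hk
    rw [hη0, map_zero] at h1
    exact (congrArg Prod.fst h1).symm

end GeneratingFunction

end TwistMap

/-! ### Second-order calculus and comparison of actions -/

namespace TwistMap

variable {d : ℕ}

/-- If the second derivative in the direction `ξ` were negative, the restriction of `f` to that line
would have a local maximum as well as a minimum at `X`, hence be locally constant with zero second
derivative. -/
theorem hessian_nonneg_of_forall_le {V : Type*} [NormedAddCommGroup V] [NormedSpace ℝ V]
    {f : V → ℝ} (hf : ContDiff ℝ 2 f) {X : V} (hX : ∀ Y, f X ≤ f Y) (ξ : V) :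
    0 ≤ fderiv ℝ (fderiv ℝ f) X ξ ξ := by
  have hf1 : ContDiff ℝ 1 (fderiv ℝ f) := hf.fderiv_right (by norm_num)
  have hfd : Differentiable ℝ f := hf.differentiable (by norm_num)
  have hpt : ∀ t : ℝ, HasDerivAt (fun t : ℝ => X + t • ξ) ξ t := fun t => by
    simpa using ((hasDerivAt_id t).smul_const ξ).const_add X
  let φ : ℝ → ℝ := fun t => f (X + t • ξ)
  have h1 : ∀ t, HasDerivAt φ (fderiv ℝ f (X + t • ξ) ξ) t := fun t =>
    (hfd _).hasFDerivAt.comp_hasDerivAt t (hpt t)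
  have h2 : HasDerivAt (fun t : ℝ => fderiv ℝ f (X + t • ξ) ξ)
      (fderiv ℝ (fderiv ℝ f) X ξ ξ) 0 := by
    have h3 := (hf1.differentiable (by norm_num) (X + (0 : ℝ) • ξ)).hasFDerivAt.comp_hasDerivAt 0
      (hpt 0)
    have h4 := (ContinuousLinearMap.apply ℝ ℝ ξ).hasFDerivAt.comp_hasDerivAt 0 h3
    exact h4.congr_deriv (by simp)
  have hd : deriv φ = fun t : ℝ => fderiv ℝ f (X + t • ξ) ξ := funext fun t => (h1 t).deriv
  have hmin : IsLocalMin φ 0 := Eventually.of_forall fun t => by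
    simpa [φ] using hX (X + t • ξ)
  by_contra! hneg
  have hmax : IsLocalMax φ 0 := by
    refine isLocalMax_of_deriv_deriv_neg ?_ hmin.deriv_eq_zero (h1 0).continuousAt
    rw [hd, h2.deriv]
    exact hneg
  have hconst : φ =ᶠ[𝓝 0] fun _ => φ 0 := by
    filter_upwards [hmin, hmax] with t ht ht' using le_antisymm ht' ht
  have h5 := hconst.deriv.deriv_eq
  rw [hd, h2.deriv] at h5
  simp at h5
  exact hneg.ne h5

theorem fderiv_sum_comp {V W : Type*} [NormedAddCommGroup V] [NormedSpace ℝ V]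
    [NormedAddCommGroup W] [NormedSpace ℝ W] {f : W → ℝ} (hf : Differentiable ℝ f)
    {A : ℕ → V → W} {P : ℕ → V →L[ℝ] W} {X : V} (hA : ∀ k, HasFDerivAt (A k) (P k) X) (n : ℕ) :
    fderiv ℝ (fun X => ∑ k ∈ Finset.range n, f (A k X)) X =
      ∑ k ∈ Finset.range n, (fderiv ℝ f (A k X)).comp (P k) :=
  (HasFDerivAt.fun_sum fun k _ => (hf _).hasFDerivAt.comp X (hA k)).fderiv

theorem fderiv_fderiv_sum_comp_apply {V W : Type*} [NormedAddCommGroup V] [NormedSpace ℝ V]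
    [NormedAddCommGroup W] [NormedSpace ℝ W] {f : W → ℝ} (hf : ContDiff ℝ 2 f)
    {A : ℕ → V → W} {P : ℕ → V →L[ℝ] W} (hA : ∀ k X, HasFDerivAt (A k) (P k) X) (n : ℕ)
    (X Ξ Z : V) :
    fderiv ℝ (fderiv ℝ fun X => ∑ k ∈ Finset.range n, f (A k X)) X Ξ Z =
      ∑ k ∈ Finset.range n, fderiv ℝ (fderiv ℝ f) (A k X) (P k Ξ) (P k Z) := by
  have hf1 : ContDiff ℝ 1 (fderiv ℝ f) := hf.fderiv_right (by norm_num)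
  have h1 : (fderiv ℝ fun X => ∑ k ∈ Finset.range n, f (A k X)) = fun X =>
      ∑ k ∈ Finset.range n, (fderiv ℝ f (A k X)).comp (P k) :=
    funext fun X => fderiv_sum_comp (hf.differentiable (by norm_num)) (fun k => hA k X) n
  have h2 : HasFDerivAt (fun X => ∑ k ∈ Finset.range n, (fderiv ℝ f (A k X)).comp (P k)) _ X :=
    HasFDerivAt.fun_sum fun k _ =>
      ((ContinuousLinearMap.compL ℝ V W ℝ).flip (P k)).hasFDerivAt.comp X
        ((hf1.differentiable (by norm_num) _).hasFDerivAt.comp X (hA k X))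
  rw [h1, h2.fderiv, sum_apply, sum_apply]
  rfl

theorem action_congr {L : E d × E d → ℝ} {x y : ℕ → E d} {n : ℕ} (h : ∀ k ≤ n, x k = y k) :
    action L x n = action L y n := by
  refine Finset.sum_congr rfl fun k hk => ?_
  have := Finset.mem_range.1 hk
  rw [h k (by omega), h (k + 1) (by omega)]

theorem actionDeriv_congr {f : E d × E d → ℝ} {x y ξ ζ : ℕ → E d} {n : ℕ}
    (h : ∀ k ≤ n, x k = y k) (h' : ∀ k ≤ n, ξ k = ζ k) :
    actionDeriv f x ξ n = actionDeriv f y ζ n := by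
  refine Finset.sum_congr rfl fun k hk => ?_
  have := Finset.mem_range.1 hk
  rw [h k (by omega), h (k + 1) (by omega), h' k (by omega), h' (k + 1) (by omega)]

theorem actionHess_congr {f : E d × E d → ℝ} {x y ξ ζ ξ' ζ' : ℕ → E d} {n : ℕ}
    (h : ∀ k ≤ n, x k = y k) (h₁ : ∀ k ≤ n, ξ k = ξ' k) (h₂ : ∀ k ≤ n, ζ k = ζ' k) :
    actionHess f x ξ ζ n = actionHess f y ξ' ζ' n := by
  refine Finset.sum_congr rfl fun k hk => ?_
  have := Finset.mem_range.1 hk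
  rw [h k (by omega), h (k + 1) (by omega), h₁ k (by omega), h₁ (k + 1) (by omega),
    h₂ k (by omega), h₂ (k + 1) (by omega)]

/-- The points of a configuration of bounded action stay at a bounded distance from the first. -/
theorem PeriodicCost.exists_norm_sub_le {L : E d × E d → ℝ} (hL : PeriodicCost L) (n : ℕ)
    (M : ℝ) : ∃ R ≥ 0, ∀ x : ℕ → E d, action L x n ≤ M → ∀ k ≤ n, ‖x k - x 0‖ ≤ R := by
  obtain ⟨C, hC0, hC⟩ := hL.exists_lower_bound
  obtain ⟨R₀, hR₀⟩ := hL.coercive (M + n * C)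
  set R := max R₀ 0
  have hR0 : 0 ≤ R := le_max_right _ _
  refine ⟨n * R, by positivity, fun x hx => ?_⟩
  have hedge : ∀ k < n, ‖x k - x (k + 1)‖ ≤ R := by
    intro k hk
    refine (hR₀ _ _ ?_).trans (le_max_left _ _)
    have h1 : L (x k, x (k + 1)) + C ≤ ∑ j ∈ Finset.range n, (L (x j, x (j + 1)) + C) :=
      Finset.single_le_sum (f := fun j => L (x j, x (j + 1)) + C)
        (fun j _ => by linarith [hC (x j, x (j + 1))]) (Finset.mem_range.2 hk)
    rw [Finset.sum_add_distrib, Finset.sum_const, Finset.card_range, nsmul_eq_mul] at h1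
    have h2 : ∑ j ∈ Finset.range n, L (x j, x (j + 1)) ≤ M := hx
    linarith
  have hk : ∀ k ≤ n, ‖x k - x 0‖ ≤ k * R := by
    intro k
    induction k with
    | zero => intro _; simp
    | succ k ih =>
      intro hk
      have h1 := ih (by omega)
      have h2 := hedge k (by omega)
      have h3 := norm_sub_le_norm_sub_add_norm_sub (x (k + 1)) (x k) (x 0)
      rw [norm_sub_rev] at h2
      push_cast
      linarith
  intro k hkn
  refine (hk k hkn).trans ?_
  gcongr

/-! ### The space of configurations with fixed endpoints -/

/-- The space of the interior points `x_1, …, x_m` of the configurations `(x_0, …, x_{m+1})`. -/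
abbrev ConfSpace (d m : ℕ) : Type := PiLp 2 fun _ : Fin m => E d

/-- The variation with zero endpoints given by an element of `ConfSpace d m`. -/
noncomputable def coord (m k : ℕ) : ConfSpace d m →L[ℝ] E d :=
  if h : 1 ≤ k ∧ k - 1 < m then PiLp.proj 2 (fun _ : Fin m => E d) ⟨k - 1, h.2⟩ else 0

/-- The configuration with endpoints `x` and `y` and the given interior points. -/
noncomputable def conf {m : ℕ} (x y : E d) (X : ConfSpace d m) (k : ℕ) : E d :=
  (if k = 0 then x else if k ≤ m then 0 else y) + coord m k X

@[simp] theorem coord_zero (m : ℕ) : coord (d := d) m 0 = 0 := by simp [coord]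

@[simp] theorem coord_last (m : ℕ) : coord (d := d) m (m + 1) = 0 := by simp [coord]

@[simp] theorem conf_zero {m : ℕ} (x y : E d) (X : ConfSpace d m) : conf x y X 0 = x := by
  simp [conf]

@[simp] theorem conf_last {m : ℕ} (x y : E d) (X : ConfSpace d m) :
    conf x y X (m + 1) = y := by
  simp [conf]

/-- The interior points of a configuration. -/
def interiorPoints (m : ℕ) (w : ℕ → E d) : ConfSpace d m :=
  WithLp.toLp 2 fun i => w (i + 1)

theorem coord_interiorPoints {m : ℕ} (w : ℕ → E d) {k : ℕ} (hk : 1 ≤ k) (hkm : k ≤ m) :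
    coord m k (interiorPoints m w) = w k := by
  rw [coord, dif_pos ⟨hk, by omega⟩]
  change w (k - 1 + 1) = w k
  rw [Nat.sub_add_cancel hk]

theorem coord_interiorPoints_of_zero {m : ℕ} {w : ℕ → E d} (h0 : w 0 = 0) (hm : w (m + 1) = 0)
    {k : ℕ} (hk : k ≤ m + 1) : coord m k (interiorPoints m w) = w k := by
  rcases Nat.eq_zero_or_pos k with rfl | h1
  · simp [h0]
  rcases hk.eq_or_lt with rfl | h2
  · simp [hm]
  · exact coord_interiorPoints w h1 (by omega)

theorem conf_interiorPoints {m : ℕ} {w : ℕ → E d} {x y : E d} (h0 : w 0 = x) (hm : w (m + 1) = y)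
    {k : ℕ} (hk : k ≤ m + 1) : conf x y (interiorPoints m w) k = w k := by
  rcases Nat.eq_zero_or_pos k with rfl | h1
  · simp [h0]
  rcases hk.eq_or_lt with rfl | h2
  · simp [hm]
  · rw [conf, if_neg (by omega), if_pos (by omega), zero_add,
      coord_interiorPoints w h1 (by omega)]

theorem apply_eq_coord {m : ℕ} (X : ConfSpace d m) (i : Fin m) : X i = coord m (i + 1) X := by
  rw [coord, dif_pos ⟨by omega, by simp⟩]
  rfl

theorem apply_eq_conf {m : ℕ} (x y : E d) (X : ConfSpace d m) (i : Fin m) :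
    X i = conf x y X (i + 1) := by
  rw [conf, if_neg (by omega), if_pos (by omega), zero_add, apply_eq_coord]

theorem continuous_conf {m : ℕ} (x y : E d) (k : ℕ) :
    Continuous fun X : ConfSpace d m => conf x y X k :=
  continuous_const.add (coord m k).continuous

theorem PeriodicCost.continuous_action_conf {L : E d × E d → ℝ} (hL : PeriodicCost L) {m : ℕ}
    (x y : E d) : Continuous fun X : ConfSpace d m => action L (conf x y X) (m + 1) :=
  continuous_finsetSum _ fun k _ =>
    hL.continuous.comp ((continuous_conf x y k).prodMk (continuous_conf x y (k + 1)))

/-- A bound on the action confines every interior point to a ball around the fixed endpoint `x`. -/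
theorem PeriodicCost.tendsto_action_conf {L : E d × E d → ℝ} (hL : PeriodicCost L) {m : ℕ}
    (x y : E d) :
    Tendsto (fun X : ConfSpace d m => action L (conf x y X) (m + 1)) (cocompact _) atTop := by
  refine tendsto_atTop.2 fun M => ?_
  obtain ⟨R, hR0, hR⟩ := hL.exists_norm_sub_le (m + 1) M
  have hball : (Metric.closedBall (0 : ConfSpace d m)
      (Real.sqrt (m * (R + ‖x‖) ^ 2)))ᶜ ∈ cocompact (ConfSpace d m) :=
    (isCompact_closedBall _ _).compl_mem_cocompact
  filter_upwards [hball] with X hX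
  by_contra! hlt
  refine hX ?_
  rw [mem_closedBall_zero_iff, PiLp.norm_eq_of_L2]
  refine Real.sqrt_le_sqrt ?_
  calc ∑ i, ‖X i‖ ^ 2 ≤ ∑ _i : Fin m, (R + ‖x‖) ^ 2 := by
        refine Finset.sum_le_sum fun i _ => ?_
        have h1 := hR _ hlt.le (i + 1) (by omega)
        rw [conf_zero, ← apply_eq_conf] at h1
        have h2 : ‖X i‖ ≤ ‖X i - x‖ + ‖x‖ := norm_le_norm_sub_add _ _
        gcongr
        linarith
    _ = m * (R + ‖x‖) ^ 2 := by simp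

/-- A configuration minimizes the action on `[0, n]` among those with the same endpoints. -/
def IsMinimizing (L : E d × E d → ℝ) (w : ℕ → E d) (n : ℕ) : Prop :=
  ∀ w' : ℕ → E d, w' 0 = w 0 → w' n = w n → action L w n ≤ action L w' n

theorem PeriodicCost.exists_isMinimizing {L : E d × E d → ℝ} (hL : PeriodicCost L) {n : ℕ}
    (hn : 1 ≤ n) (x y : E d) : ∃ w : ℕ → E d, w 0 = x ∧ w n = y ∧ IsMinimizing L w n := by
  obtain ⟨m, rfl⟩ := Nat.exists_eq_add_of_le' hn
  obtain ⟨X, hX⟩ := (hL.continuous_action_conf (m := m) x y).exists_forall_le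
    (hL.tendsto_action_conf x y)
  refine ⟨conf x y X, conf_zero _ _ _, conf_last _ _ _, fun w' h0 hn => ?_⟩
  rw [conf_zero] at h0
  rw [conf_last] at hn
  refine (hX (interiorPoints m w')).trans_eq ?_
  exact action_congr fun k hk => conf_interiorPoints h0 hn hk

/-! ### First and second variations -/

namespace GeneratingFunction

variable (S : GeneratingFunction d)

theorem hasFDerivAt_conf {m : ℕ} (x y : E d) (X : ConfSpace d m) (k : ℕ) :
    HasFDerivAt (fun X : ConfSpace d m => (conf x y X k, conf x y X (k + 1)))
      ((coord m k).prod (coord m (k + 1))) X :=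
  ((coord m k).hasFDerivAt.const_add _).prodMk ((coord m (k + 1)).hasFDerivAt.const_add _)

theorem contDiff_action_conf {m : ℕ} (x y : E d) :
    ContDiff ℝ 2 fun X : ConfSpace d m => action S.toFun (conf x y X) (m + 1) := by
  refine ContDiff.sum fun k _ => S.contDiff.comp ?_
  exact (contDiff_const.add (coord m k).contDiff).prodMk
    (contDiff_const.add (coord m (k + 1)).contDiff)

theorem fderiv_action_conf_apply {m : ℕ} (x y : E d) (X Ξ : ConfSpace d m) :
    fderiv ℝ (fun X : ConfSpace d m => action S.toFun (conf x y X) (m + 1)) X Ξ =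
      actionDeriv S.toFun (conf x y X) (fun k => coord m k Ξ) (m + 1) :=
  congrArg (fun T : ConfSpace d m →L[ℝ] ℝ => T Ξ) (fderiv_sum_comp S.differentiable
    (fun k => hasFDerivAt_conf x y X k) (m + 1)) |>.trans (sum_apply _ _ _)

theorem fderiv_fderiv_action_conf_apply {m : ℕ} (x y : E d) (X Ξ Z : ConfSpace d m) :
    fderiv ℝ (fderiv ℝ fun X : ConfSpace d m => action S.toFun (conf x y X) (m + 1)) X Ξ Z =
      actionHess S.toFun (conf x y X) (fun k => coord m k Ξ) (fun k => coord m k Z) (m + 1) :=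
  fderiv_fderiv_sum_comp_apply S.contDiff (fun k X => hasFDerivAt_conf x y X k) (m + 1) X Ξ Z

theorem isStationary_conf_iff {m : ℕ} (x y : E d) (X : ConfSpace d m) :
    S.IsStationary (conf x y X) (m + 1) ↔
      fderiv ℝ (fun X : ConfSpace d m => action S.toFun (conf x y X) (m + 1)) X = 0 := by
  constructor
  · intro h
    ext Ξ
    rw [fderiv_action_conf_apply]
    exact h _ (by simp) (by simp)
  · intro h ξ h0 hm
    have h1 := S.fderiv_action_conf_apply x y X (interiorPoints m ξ)
    rw [h] at h1
    rw [← actionDeriv_congr (fun _ _ => rfl) fun k hk => coord_interiorPoints_of_zero h0 hm hk,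
      ← h1]
    rfl

/-! ### Positivity of the second variation and uniqueness of stationary configurations -/

variable {S}

theorem IsStationary.congr {x y : ℕ → E d} {n : ℕ} (hx : S.IsStationary x n)
    (h : ∀ k ≤ n, y k = x k) : S.IsStationary y n := fun ξ h0 hn => by
  rw [actionDeriv_congr h fun _ _ => rfl]
  exact hx ξ h0 hn

theorem isStationary_of_isMinimizing {w : ℕ → E d} {n : ℕ} (hn : 1 ≤ n)
    (hw : IsMinimizing S.toFun w n) : S.IsStationary w n := by
  obtain ⟨m, rfl⟩ := Nat.exists_eq_add_of_le' hn
  have hc : ∀ k ≤ m + 1, conf (w 0) (w (m + 1)) (interiorPoints m w) k = w k := fun k hk =>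
    conf_interiorPoints rfl rfl hk
  refine IsStationary.congr ((S.isStationary_conf_iff _ _ _).2 ?_) fun k hk => (hc k hk).symm
  refine IsLocalMin.fderiv_eq_zero (Eventually.of_forall fun X => ?_)
  simp only [action_congr hc]
  exact hw _ (conf_zero _ _ _) (conf_last _ _ _)

theorem actionHess_nonneg_of_isMinimizing {w : ℕ → E d} {m : ℕ}
    (hw : IsMinimizing S.toFun w (m + 1)) (Ξ : ConfSpace d m) :
    0 ≤ actionHess S.toFun w (fun k => coord m k Ξ) (fun k => coord m k Ξ) (m + 1) := by
  have hc : ∀ k ≤ m + 1, conf (w 0) (w (m + 1)) (interiorPoints m w) k = w k := fun k hk =>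
    conf_interiorPoints rfl rfl hk
  rw [← actionHess_congr hc (fun _ _ => rfl) (fun _ _ => rfl),
    ← fderiv_fderiv_action_conf_apply]
  refine hessian_nonneg_of_forall_le (S.contDiff_action_conf _ _) (fun X => ?_) Ξ
  simp only [action_congr hc]
  exact hw _ (conf_zero _ _ _) (conf_last _ _ _)

variable (S) in
theorem actionHess_add_smul (x : ℕ → E d) {m n : ℕ} (Ξ Z : ConfSpace d m) (t : ℝ) :
    actionHess S.toFun x (fun k => coord m k (Z + t • Ξ)) (fun k => coord m k (Z + t • Ξ)) n =
      actionHess S.toFun x (fun k => coord m k Z) (fun k => coord m k Z) n +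
      2 * t * actionHess S.toFun x (fun k => coord m k Ξ) (fun k => coord m k Z) n +
      t ^ 2 * actionHess S.toFun x (fun k => coord m k Ξ) (fun k => coord m k Ξ) n := by
  simp only [actionHess, Finset.mul_sum, ← Finset.sum_add_distrib]
  refine Finset.sum_congr rfl fun k _ => ?_
  have h : ∀ k, ((coord m k (Z + t • Ξ), coord m (k + 1) (Z + t • Ξ)) : E d × E d) =
      (coord m k Z, coord m (k + 1) Z) + t • (coord m k Ξ, coord m (k + 1) Ξ) := fun k => by
    simp
  rw [h]
  simp only [map_add, map_smul, add_apply, smul_apply, smul_eq_mul]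
  rw [S.hess_symm _ (coord m k Z, coord m (k + 1) Z) (coord m k Ξ, coord m (k + 1) Ξ)]
  ring

/-- Without conjugate points, a nonnegative second variation is positive. -/
theorem WithoutConjugatePoints.actionHess_pos_of_nonneg (hS : S.WithoutConjugatePoints)
    {z : E d × Dual d} {m : ℕ} (h : ∀ Ξ : ConfSpace d m, 0 ≤
      actionHess S.toFun (S.orbit z) (fun k => coord m k Ξ) (fun k => coord m k Ξ) (m + 1))
    {Ξ : ConfSpace d m} (hΞ : Ξ ≠ 0) : 0 <
      actionHess S.toFun (S.orbit z) (fun k => coord m k Ξ) (fun k => coord m k Ξ) (m + 1) := by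
  refine (h Ξ).lt_of_ne fun h0 => hΞ ?_
  -- A null vector of a nonnegative quadratic form lies in its kernel: with the `t²` term gone, an
  -- affine function of `t` stays nonnegative, so its slope vanishes.
  have hker : ∀ Z : ConfSpace d m,
      actionHess S.toFun (S.orbit z) (fun k => coord m k Ξ) (fun k => coord m k Z) (m + 1) = 0 := by
    intro Z
    set q := actionHess S.toFun (S.orbit z) (fun k => coord m k Ξ) (fun k => coord m k Z) (m + 1)
    set p := actionHess S.toFun (S.orbit z) (fun k => coord m k Z) (fun k => coord m k Z) (m + 1)
    have h1 : ∀ t : ℝ, 0 ≤ p + 2 * t * q := fun t => by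
      have := h (Z + t • Ξ)
      rwa [actionHess_add_smul, ← h0, mul_zero, add_zero] at this
    by_contra hq
    -- At this `t` the affine function equals `-1`.
    have := h1 (-(p + 1) / (2 * q))
    field_simp at this
    linarith
  have hJ : ∀ k ≤ m + 1, coord m k Ξ = 0 := fun k hk =>
    hS.jacobi_eq_zero z (n := m + 1) (ξ := fun k => coord m k Ξ) (by simp) (by simp) ?_ hk
  · refine PiLp.ext fun i => ?_
    rw [apply_eq_coord]
    exact hJ _ (by omega)
  · intro k hk v
    -- Testing against a variation supported at a single vertex involves only its two adjacent edges
    -- and yields the Jacobi equation there.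
    have h1 := hker (interiorPoints m (Pi.single (k + 1) v))
    rw [actionHess_congr (fun _ _ => rfl) (fun _ _ => rfl) fun j hj =>
      coord_interiorPoints_of_zero (Pi.single_eq_of_ne (by omega) _)
        (Pi.single_eq_of_ne (by omega) _) hj, actionHess, sum_apply_single (fun k =>
        fderiv ℝ (fderiv ℝ S.toFun) (S.orbit z k, S.orbit z (k + 1))
          (coord m k Ξ, coord m (k + 1) Ξ)) hk] at h1
    exact h1

theorem continuous_actionHess_orbit (m : ℕ) :
    Continuous fun p : (E d × Dual d) × ConfSpace d m => actionHess S.toFun (S.orbit p.1)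
      (fun k => coord m k p.2) (fun k => coord m k p.2) (m + 1) := by
  refine continuous_finsetSum _ fun k _ => ?_
  have h1 : Continuous (fderiv ℝ (fderiv ℝ S.toFun)) :=
    S.contDiff_fderiv.continuous_fderiv (by norm_num)
  have h2 : Continuous fun p : (E d × Dual d) × ConfSpace d m =>
      (S.orbit p.1 k, S.orbit p.1 (k + 1)) :=
    ((S.continuous_orbit k).comp continuous_fst).prodMk
      ((S.continuous_orbit (k + 1)).comp continuous_fst)
  have h3 : Continuous fun p : (E d × Dual d) × ConfSpace d m =>
      (coord m k p.2, coord m (k + 1) p.2) := by fun_prop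
  exact ((h1.comp h2).clm_apply h3).clm_apply h3

/-- Without conjugate points, the second variation is positive along every orbit. -/
theorem WithoutConjugatePoints.actionHess_orbit_pos (hS : S.WithoutConjugatePoints) (m : ℕ)
    (z : E d × Dual d) {Ξ : ConfSpace d m} (hΞ : Ξ ≠ 0) : 0 <
      actionHess S.toFun (S.orbit z) (fun k => coord m k Ξ) (fun k => coord m k Ξ) (m + 1) := by
  let P : Set (E d × Dual d) := {z | ∀ Ξ : ConfSpace d m, 0 ≤
      actionHess S.toFun (S.orbit z) (fun k => coord m k Ξ) (fun k => coord m k Ξ) (m + 1)}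
  suffices h : P = Set.univ from
    hS.actionHess_pos_of_nonneg (h ▸ Set.mem_univ z : z ∈ P) hΞ
  have hclosed : IsClosed P := by
    have : P = ⋂ Ξ : ConfSpace d m, {z | 0 ≤ actionHess S.toFun (S.orbit z)
        (fun k => coord m k Ξ) (fun k => coord m k Ξ) (m + 1)} := by
      ext z; simp [P]
    rw [this]
    exact isClosed_iInter fun Ξ => isClosed_le continuous_const
      ((continuous_actionHess_orbit m).comp (continuous_id.prodMk continuous_const))
  have h0 : ∀ x ξ : ℕ → E d, actionHess S.toFun x ξ
      (fun k => coord m k (0 : ConfSpace d m)) (m + 1) = 0 := fun x ξ =>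
    Finset.sum_eq_zero fun k _ => by
      simp only [map_zero]
      exact map_zero _
  -- At a point of `P` the form is strictly positive on the unit sphere. Compactness of the sphere
  -- preserves this nearby, and homogeneity extends it to all vectors.
  have hopen : IsOpen P := by
    refine isOpen_iff_mem_nhds.2 fun z hz => ?_
    have h1 := (isCompact_sphere (0 : ConfSpace d m) 1).eventually_forall_of_forall_eventually
      (x₀ := z) (P := fun z Ξ => 0 < actionHess S.toFun (S.orbit z)
        (fun k => coord m k Ξ) (fun k => coord m k Ξ) (m + 1)) fun Ξ hΞ => by
      refine (continuous_actionHess_orbit (S := S) m).continuousAt.eventually_const_lt ?_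
      refine hS.actionHess_pos_of_nonneg hz ?_
      rintro rfl
      simp at hΞ
    filter_upwards [h1] with z' hz' Ξ
    rcases eq_or_ne Ξ 0 with rfl | hΞ
    · exact (h0 _ _).ge
    have h2 := hz' (‖Ξ‖⁻¹ • Ξ) (by simp [norm_smul, hΞ])
    have h3 := S.actionHess_add_smul (S.orbit z') (n := m + 1) (‖Ξ‖⁻¹ • Ξ) 0 ‖Ξ‖
    have h4 : ‖Ξ‖ ≠ 0 := norm_ne_zero_iff.2 hΞ
    rw [zero_add, smul_smul, mul_inv_cancel₀ h4, one_smul] at h3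
    rw [h3]
    rw [h0, h0]
    have : 0 ≤ ‖Ξ‖ ^ 2 := by positivity
    nlinarith
  refine IsClopen.eq_univ ⟨hclosed, hopen⟩ ?_
  -- A minimizing configuration is an orbit with nonnegative second variation, so `P` is nonempty.
  obtain ⟨w, -, -, hw⟩ := S.periodicCost.exists_isMinimizing (n := m + 1) (by omega) 0 0
  have hst := isStationary_of_isMinimizing (by omega) hw
  refine ⟨S.legendre (w 0, w 1), fun Ξ => ?_⟩
  rw [actionHess_congr (fun k hk => S.orbit_eq_of_euler_lagrange (n := m + 1)
    (fun k hk => hst.euler_lagrange (k := k) hk) hk) (fun _ _ => rfl) fun _ _ => rfl]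
  exact actionHess_nonneg_of_isMinimizing hw Ξ

/-- Without conjugate points, a stationary configuration is determined by its endpoints. -/
theorem IsStationary.eq_of_endpoints (hS : S.WithoutConjugatePoints) {v w : ℕ → E d} {n : ℕ}
    (hn : 1 ≤ n) (hv : S.IsStationary v n) (hw : S.IsStationary w n) (h0 : v 0 = w 0)
    (hvw : v n = w n) {k : ℕ} (hk : k ≤ n) : v k = w k := by
  obtain ⟨m, rfl⟩ := Nat.exists_eq_add_of_le' hn
  have hcv : ∀ k ≤ m + 1, conf (w 0) (w (m + 1)) (interiorPoints m v) k = v k := fun k hk =>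
    conf_interiorPoints h0 hvw hk
  have hcw : ∀ k ≤ m + 1, conf (w 0) (w (m + 1)) (interiorPoints m w) k = w k := fun k hk =>
    conf_interiorPoints rfl rfl hk
  have key : interiorPoints m v = interiorPoints m w := by
    refine eq_of_fderiv_eq_zero_of_hessian_pos (S.contDiff_action_conf (w 0) (w (m + 1)))
      (S.periodicCost.tendsto_action_conf _ _) ?_
      ((S.isStationary_conf_iff _ _ _).1 (hv.congr hcv))
      ((S.isStationary_conf_iff _ _ _).1 (hw.congr hcw))
    -- A critical point is a piece of orbit, along which the second variation is positive.
    intro X hX Ξ hΞ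
    have hst := (S.isStationary_conf_iff _ _ _).2 hX
    rw [fderiv_fderiv_action_conf_apply, ← actionHess_congr (fun k hk =>
      S.orbit_eq_of_euler_lagrange (n := m + 1) (fun k hk => hst.euler_lagrange (k := k) hk) hk)
      (fun _ _ => rfl) fun _ _ => rfl]
    exact hS.actionHess_orbit_pos m _ hΞ
  rw [← hcv k hk, ← hcw k hk, key]

/-- Without conjugate points, stationary configurations are minimizing. -/
theorem IsStationary.isMinimizing (hS : S.WithoutConjugatePoints) {w : ℕ → E d} {n : ℕ}
    (hn : 1 ≤ n) (hw : S.IsStationary w n) : IsMinimizing S.toFun w n := by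
  obtain ⟨v, h0, hvn, hv⟩ := S.periodicCost.exists_isMinimizing hn (w 0) (w n)
  have heq := fun k hk => IsStationary.eq_of_endpoints hS hn
    (isStationary_of_isMinimizing hn hv) hw h0 hvn (k := k) hk
  intro w' h0' hn'
  rw [← action_congr heq]
  exact hv w' (h0'.trans h0.symm) (hn'.trans hvn.symm)

end GeneratingFunction

end TwistMap

namespace TwistMap

variable {d : ℕ}

/-! ### Concatenation and periodization of configurations -/

theorem action_add (L : E d × E d → ℝ) (x : ℕ → E d) (m n : ℕ) :
    action L x (m + n) = action L x m + action L (fun k => x (m + k)) n := by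
  simp only [action, Finset.sum_range_add, add_assoc]

theorem actionDeriv_add (f : E d × E d → ℝ) (x ξ : ℕ → E d) (m n : ℕ) :
    actionDeriv f x ξ (m + n) =
      actionDeriv f x ξ m + actionDeriv f (fun k => x (m + k)) (fun k => ξ (m + k)) n := by
  simp only [actionDeriv, Finset.sum_range_add, add_assoc]

theorem PeriodicCost.action_add_latticeVec {L : E d × E d → ℝ} (hL : PeriodicCost L)
    (r : Fin d → ℤ) (x : ℕ → E d) (n : ℕ) :
    action L (fun k => x k + latticeVec r) n = action L x n :=
  Finset.sum_congr rfl fun k _ => hL.periodic r (x k) (x (k + 1))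

/-- The configuration which follows `a` up to time `n` and then `b`. -/
def concat (a : ℕ → E d) (n : ℕ) (b : ℕ → E d) (k : ℕ) : E d :=
  if k ≤ n then a k else b (k - n)

theorem concat_of_le {a b : ℕ → E d} {n k : ℕ} (hk : k ≤ n) : concat a n b k = a k := if_pos hk

theorem concat_add {a b : ℕ → E d} {n : ℕ} (h : a n = b 0) (k : ℕ) :
    concat a n b (n + k) = b k := by
  rcases Nat.eq_zero_or_pos k with rfl | hk
  · rw [add_zero, concat_of_le le_rfl, h]
  · rw [concat, if_neg (by omega), Nat.add_sub_cancel_left]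

theorem action_concat (L : E d × E d → ℝ) {a b : ℕ → E d} {n : ℕ} (h : a n = b 0) (m : ℕ) :
    action L (concat a n b) (n + m) = action L a n + action L b m := by
  rw [action_add, action_congr fun k hk => concat_of_le hk]
  simp only [concat_add h]

/-- The infinite configuration obtained by repeating a loop `w` of length `n` with `w n = w 0 + r`. -/
noncomputable def periodize (w : ℕ → E d) (n : ℕ) (r : Fin d → ℤ) (k : ℕ) : E d :=
  w (k % n) + latticeVec ((k / n) • r)

theorem periodize_mul_add {w : ℕ → E d} {n : ℕ} {r : Fin d → ℤ} (hn : 1 ≤ n)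
    (hw : w n = w 0 + latticeVec r) (q : ℕ) {j : ℕ} (hj : j ≤ n) :
    periodize w n r (q * n + j) = w j + latticeVec (q • r) := by
  rcases hj.eq_or_lt with rfl | hj
  · have h : q * j + j = (q + 1) * j := by ring
    rw [periodize, h, Nat.mul_mod_left, Nat.mul_div_cancel _ hn, hw, add_smul, one_smul,
      latticeVec_add]
    abel
  · rw [periodize, add_comm (q * n), Nat.add_mul_mod_self_right, Nat.mod_eq_of_lt hj,
      Nat.add_mul_div_right _ _ hn, Nat.div_eq_of_lt hj, zero_add]

theorem periodize_mul {w : ℕ → E d} {n : ℕ} {r : Fin d → ℤ} (hn : 1 ≤ n)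
    (hw : w n = w 0 + latticeVec r) (q : ℕ) :
    periodize w n r (q * n) = w 0 + latticeVec (q • r) :=
  periodize_mul_add hn hw q (Nat.zero_le n)

theorem PeriodicCost.action_periodize {L : E d × E d → ℝ} (hL : PeriodicCost L) {w : ℕ → E d}
    {n : ℕ} {r : Fin d → ℤ} (hn : 1 ≤ n) (hw : w n = w 0 + latticeVec r) (q : ℕ) :
    action L (periodize w n r) (q * n) = q * action L w n := by
  induction q with
  | zero => simp [action]
  | succ q ih =>
    rw [Nat.succ_mul, action_add, ih, action_congr fun j hj => periodize_mul_add hn hw q hj,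
      hL.action_add_latticeVec]
    push_cast
    ring

theorem exists_tendsto_subseq {n : ℕ} {y : ℕ → ℕ → E d} {R : ℝ}
    (h : ∀ j, ∀ k ≤ n, ‖y j k‖ ≤ R) : ∃ (z : ℕ → E d) (φ : ℕ → ℕ), StrictMono φ ∧
      ∀ k ≤ n, Tendsto (fun j => y (φ j) k) atTop (𝓝 (z k)) := by
  have hK : IsCompact (Set.univ.pi fun _ : Fin (n + 1) => Metric.closedBall (0 : E d) R) :=
    isCompact_univ_pi fun _ => isCompact_closedBall _ _
  obtain ⟨z, -, φ, hφ, hz⟩ := hK.tendsto_subseq (x := fun j (i : Fin (n + 1)) => y j i)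
    fun j i _ => by simpa using h j i (by omega)
  refine ⟨fun k => if hk : k < n + 1 then z ⟨k, hk⟩ else 0, φ, hφ, fun k hk => ?_⟩
  have hk' : k < n + 1 := by omega
  simp only [dif_pos hk']
  exact (tendsto_pi_nhds.1 hz) ⟨k, hk'⟩

theorem tendsto_action {L : E d × E d → ℝ} (hL : Continuous L) {n : ℕ} {y : ℕ → ℕ → E d}
    {z : ℕ → E d} (h : ∀ k ≤ n, Tendsto (fun j => y j k) atTop (𝓝 (z k))) :
    Tendsto (fun j => action L (y j) n) atTop (𝓝 (action L z n)) := by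
  refine tendsto_finsetSum _ fun k hk => (hL.tendsto _).comp ?_
  have := Finset.mem_range.1 hk
  exact (h k (by omega)).prodMk_nhds (h (k + 1) (by omega))

theorem tendsto_actionDeriv {f : E d × E d → ℝ} (hf : Continuous (fderiv ℝ f)) {n : ℕ}
    {y : ℕ → ℕ → E d} {z : ℕ → E d} (h : ∀ k ≤ n, Tendsto (fun j => y j k) atTop (𝓝 (z k)))
    (ξ : ℕ → E d) :
    Tendsto (fun j => actionDeriv f (y j) ξ n) atTop (𝓝 (actionDeriv f z ξ n)) := by
  refine tendsto_finsetSum _ fun k hk => ?_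
  have := Finset.mem_range.1 hk
  exact ((hf.clm_apply continuous_const).tendsto (z k, z (k + 1))).comp
    ((h k (by omega)).prodMk_nhds (h (k + 1) (by omega)))

theorem actionDeriv_sub (f : E d × E d → ℝ) (x ξ ζ : ℕ → E d) (n : ℕ) :
    actionDeriv f x (fun k => ξ k - ζ k) n = actionDeriv f x ξ n - actionDeriv f x ζ n := by
  simp only [actionDeriv, ← Finset.sum_sub_distrib, ← map_sub, Prod.mk_sub_mk]

theorem hasDerivAt_action_translate {f : E d × E d → ℝ} (hf : Differentiable ℝ f) (x : ℕ → E d)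
    (v : E d) (n : ℕ) (t : ℝ) : HasDerivAt (fun t : ℝ => action f (fun k => x k + t • v) n)
      (actionDeriv f (fun k => x k + t • v) (fun _ => v) n) t := by
  have hpt : ∀ y : E d, HasDerivAt (fun t : ℝ => y + t • v) v t := fun y => by
    simpa using ((hasDerivAt_id t).smul_const v).const_add y
  exact HasDerivAt.fun_sum fun k _ =>
    (hf _).hasFDerivAt.comp_hasDerivAt t ((hpt (x k)).prodMk (hpt (x (k + 1))))

/-! ### Loops and the independence of their minimal action from the base point -/

namespace GeneratingFunction

variable {S : GeneratingFunction d}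

/-- If the first variation of the action of a loop vanishes along the variations through loops,
its periodization is stationary. -/
theorem isStationary_periodize {w : ℕ → E d} {n : ℕ} {r : Fin d → ℤ} (hn : 1 ≤ n)
    (hw : w n = w 0 + latticeVec r)
    (h : ∀ ξ : ℕ → E d, ξ n = ξ 0 → actionDeriv S.toFun w ξ n = 0) (q : ℕ) :
    S.IsStationary (periodize w n r) (q * n) := by
  -- The first variation along `ξ` depends only on the jump `ξ n - ξ 0`, since two variations with
  -- the same jump differ by a variation through loops. `η v` is a representative of the jump `v`,
  -- and the sum over successive periods telescopes.
  let η : E d → ℕ → E d := fun v k => if k = 0 then 0 else v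
  have hη : ∀ ξ : ℕ → E d, actionDeriv S.toFun w ξ n =
      actionDeriv S.toFun w (η (ξ n - ξ 0)) n := by
    intro ξ
    rw [← sub_eq_zero, ← actionDeriv_sub]
    refine h _ ?_
    simp [η, show n ≠ 0 by omega]
  have hηsub : ∀ v v', actionDeriv S.toFun w (η (v - v')) n =
      actionDeriv S.toFun w (η v) n - actionDeriv S.toFun w (η v') n := by
    intro v v'
    rw [← actionDeriv_sub]
    congr 1
    funext k
    by_cases hk : k = 0 <;> simp [η, hk]
  have key : ∀ (ξ : ℕ → E d) (q : ℕ), actionDeriv S.toFun (periodize w n r) ξ (q * n) =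
      actionDeriv S.toFun w (η (ξ (q * n))) n - actionDeriv S.toFun w (η (ξ 0)) n := by
    intro ξ q
    induction q with
    | zero => simp [actionDeriv]
    | succ q ih =>
      have h1 : actionDeriv S.toFun (fun k => periodize w n r (q * n + k))
          (fun k => ξ (q * n + k)) n = actionDeriv S.toFun w (fun k => ξ (q * n + k)) n := by
        rw [actionDeriv_congr (fun j hj => periodize_mul_add hn hw q hj) fun _ _ => rfl]
        exact Finset.sum_congr rfl fun k _ => by rw [S.fderiv_periodic]
      rw [Nat.succ_mul, actionDeriv_add, ih, h1, hη fun k => ξ (q * n + k), add_zero, hηsub]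
      ring
  intro ξ h0 hq
  rw [key, hq, h0, sub_self]

/-- If `w` maximizes the minimal action of the loops of type `(n, r)` among all base points, then the
first variation of its action along translations is nonpositive. -/
theorem WithoutConjugatePoints.actionDeriv_translate_nonpos (hS : S.WithoutConjugatePoints)
    {w : ℕ → E d} {n : ℕ} {r : Fin d → ℤ} (hn : 1 ≤ n) (hw : w n = w 0 + latticeVec r)
    (hmin : IsMinimizing S.toFun w n)
    (hmax : ∀ x, ∃ y : ℕ → E d, y 0 = x ∧ y n = x + latticeVec r ∧
      action S.toFun y n ≤ action S.toFun w n) (v : E d) :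
    actionDeriv S.toFun w (fun _ => v) n ≤ 0 := by
  -- Translate the competitor based at `w 0 + t v` back to the endpoints of `w`. Moved along `s v`,
  -- its action is at least that of `w` at `s = 0` by minimality and at most that of `w` at `s = t`
  -- by `hmax`, so its derivative is nonpositive somewhere in between.
  have hex : ∀ t : ℝ, 0 < t → ∃ (y : ℕ → E d) (s : ℝ), y 0 = w 0 ∧ y n = w n ∧
      action S.toFun (fun k => y k + t • v) n ≤ action S.toFun w n ∧ 0 < s ∧ s < t ∧
      actionDeriv S.toFun (fun k => y k + s • v) (fun _ => v) n ≤ 0 := by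
    intro t ht
    obtain ⟨y, h0, h1, h2⟩ := hmax (w 0 + t • v)
    have hy : (fun k => y k - t • v + t • v) = y := by funext k; abel
    have e0 : y 0 - t • v = w 0 := by rw [h0]; abel
    have e1 : y n - t • v = w n := by rw [h1, hw]; abel
    obtain ⟨s, hs, hslope⟩ := exists_hasDerivAt_eq_slope
      (fun s : ℝ => action S.toFun (fun k => (y k - t • v) + s • v) n) _ ht
      (fun s _ => (hasDerivAt_action_translate S.differentiable _ v n s).continuousAt.continuousWithinAt)
      (fun s _ => hasDerivAt_action_translate S.differentiable (fun k => y k - t • v) v n s)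
    refine ⟨fun k => y k - t • v, s, e0, e1, by rwa [hy], hs.1, hs.2, ?_⟩
    rw [hslope, hy]
    simp only [zero_smul, add_zero]
    have h3 := hmin (fun k => y k - t • v) e0 e1
    exact div_nonpos_of_nonpos_of_nonneg (by linarith) (by linarith)
  choose! y s hy0 hyn hya hs0 hst hyd using hex
  let t : ℕ → ℝ := fun j => 1 / ((j : ℝ) + 1)
  have ht0 : ∀ j, 0 < t j := fun j => Nat.one_div_pos_of_nat
  have ht : Tendsto t atTop (𝓝 0) := tendsto_one_div_add_atTop_nhds_zero_nat
  have hs : Tendsto (fun j => s (t j)) atTop (𝓝 0) :=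
    squeeze_zero (fun j => (hs0 _ (ht0 j)).le) (fun j => (hst _ (ht0 j)).le) ht
  have hv : ∀ {τ : ℕ → ℝ}, Tendsto τ atTop (𝓝 0) → Tendsto (fun j => τ j • v) atTop (𝓝 0) :=
    fun hτ => by simpa using hτ.smul_const v
  obtain ⟨R, hR0, hR⟩ := S.periodicCost.exists_norm_sub_le n (action S.toFun w n)
  have hbd : ∀ j, ∀ k ≤ n, ‖y (t j) k‖ ≤ R + ‖w 0‖ := by
    intro j k hk
    have h1 := hR _ (hya _ (ht0 j)) k hk
    rw [hy0 _ (ht0 j), add_sub_add_right_eq_sub] at h1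
    exact (norm_le_norm_sub_add _ (w 0)).trans (by linarith)
  obtain ⟨z, φ, hφ, hz⟩ := exists_tendsto_subseq hbd
  have htr : ∀ {τ : ℕ → ℝ}, Tendsto τ atTop (𝓝 0) → ∀ k ≤ n,
      Tendsto (fun j => y (t (φ j)) k + τ (φ j) • v) atTop (𝓝 (z k)) := fun hτ k hk => by
    simpa using (hz k hk).add ((hv hτ).comp hφ.tendsto_atTop)
  have hz0 : z 0 = w 0 := by
    refine tendsto_nhds_unique (hz 0 (Nat.zero_le n)) ?_
    simp only [hy0 _ (ht0 _)]
    exact tendsto_const_nhds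
  have hzn : z n = w n := by
    refine tendsto_nhds_unique (hz n le_rfl) ?_
    simp only [hyn _ (ht0 _)]
    exact tendsto_const_nhds
  have hzw : action S.toFun z n ≤ action S.toFun w n :=
    le_of_tendsto (tendsto_action S.contDiff.continuous (htr ht))
      (Eventually.of_forall fun j => hya _ (ht0 _))
  -- The limit as `t → 0` is again a minimizer with the endpoints of `w`, so uniqueness identifies
  -- it with `w`. This replaces differentiability of the minimal action in the base point.
  have hzmin : IsMinimizing S.toFun z n := fun w' h0 h1 =>
    hzw.trans (hmin w' (h0.trans hz0) (h1.trans hzn))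
  have heq : ∀ k ≤ n, z k = w k := fun k hk => IsStationary.eq_of_endpoints hS hn
    (isStationary_of_isMinimizing hn hzmin) (isStationary_of_isMinimizing hn hmin) hz0 hzn hk
  rw [← actionDeriv_congr heq fun _ _ => rfl]
  exact le_of_tendsto (tendsto_actionDeriv S.contDiff_fderiv.continuous (htr hs) _)
    (Eventually.of_forall fun j => hyd _ (ht0 _))

/-- Without conjugate points, the minimal action of the loops of type `(n, r)` based at `x` does not
depend on `x`. -/
theorem WithoutConjugatePoints.exists_loop_action_le (hS : S.WithoutConjugatePoints)
    {w : ℕ → E d} {n : ℕ} {r : Fin d → ℤ} (hn : 1 ≤ n) (hw : w n = w 0 + latticeVec r)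
    (x : E d) : ∃ y : ℕ → E d, y 0 = x ∧ y n = x + latticeVec r ∧
      action S.toFun y n ≤ action S.toFun w n := by
  have hL := S.periodicCost
  choose W hW0 hWn hW using fun x : E d => hL.exists_isMinimizing hn x (x + latticeVec r)
  let f : E d → ℝ := fun x => action S.toFun (W x) n
  have hW' : ∀ x, W x n = W x 0 + latticeVec r := fun x => by rw [hW0, hWn]
  have hf : ∀ x (y : ℕ → E d), y 0 = x → y n = x + latticeVec r → f x ≤ action S.toFun y n :=
    fun x y h0 h1 => hW x y (h0.trans (hW0 x).symm) (h1.trans (hWn x).symm)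
  -- Translates of the minimal loop at `x` are competitors at nearby base points.
  have husc : UpperSemicontinuous f := by
    intro x c hc
    have h1 : Continuous fun z => action S.toFun (fun k => W x k + (z - x)) n :=
      continuous_finsetSum _ fun k _ => hL.continuous.comp (by fun_prop)
    have h2 : action S.toFun (fun k => W x k + (x - x)) n < c := by simpa using hc
    filter_upwards [h1.continuousAt.eventually_lt_const h2] with z hz
    refine (hf z _ ?_ ?_).trans_lt hz
    · rw [hW0]; abel
    · rw [hWn]; abel
  obtain ⟨x₀, -, hx₀⟩ := (husc.upperSemicontinuousOn _).exists_isMaxOn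
    (⟨0, by simp⟩ : (Metric.closedBall (0 : E d) (Real.sqrt d)).Nonempty)
    (isCompact_closedBall _ _)
  have hmax : ∀ z, f z ≤ f x₀ := by
    intro z
    obtain ⟨s, hs⟩ := exists_norm_sub_latticeVec_le z
    refine le_trans ?_ (hx₀ (show z - latticeVec s ∈ _ by simpa using hs))
    change f z ≤ action S.toFun (W (z - latticeVec s)) n
    rw [← hL.action_add_latticeVec s (W (z - latticeVec s)) n]
    refine hf z _ ?_ ?_
    · rw [hW0]; abel
    · rw [hWn]; abel
  have hD : ∀ v, actionDeriv S.toFun (W x₀) (fun _ => v) n ≤ 0 :=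
    hS.actionDeriv_translate_nonpos hn (hW' x₀) (hW x₀)
      fun x => ⟨W x, hW0 x, hWn x, hmax x⟩
  have hD0 : ∀ v, actionDeriv S.toFun (W x₀) (fun _ => v) n = 0 := by
    intro v
    refine le_antisymm (hD v) ?_
    have h1 := hD (-v)
    have h2 := actionDeriv_sub S.toFun (W x₀) (fun _ => 0) (fun _ => v) n
    have h3 := actionDeriv_sub S.toFun (W x₀) (fun _ => v) (fun _ => v) n
    simp only [sub_self, zero_sub] at h2 h3
    linarith
  -- A variation through loops is a translation plus a variation fixing the endpoints.
  have hloop : ∀ ξ : ℕ → E d, ξ n = ξ 0 → actionDeriv S.toFun (W x₀) ξ n = 0 := by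
    intro ξ hξ
    have h1 := isStationary_of_isMinimizing hn (hW x₀) (fun k => ξ k - ξ 0) (by simp)
      (by simp [hξ])
    rwa [actionDeriv_sub, hD0, sub_zero] at h1
  have hconst : ∀ z, f x₀ ≤ f z := by
    intro z
    obtain ⟨a, ha0, han, -⟩ := hL.exists_isMinimizing hn x₀ z
    -- The return path adds the displacement `2r` because the two connecting arcs, of `n` steps
    -- each, replace two periods.
    obtain ⟨b, hb0, hbn, -⟩ := hL.exists_isMinimizing hn z (x₀ + 2 • latticeVec r)
    -- The periodized loop at `x₀` minimizes over `q + 2` periods. The competitor goes to `z`, makes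
    -- `q` turns of the minimal loop there, and returns; the connecting cost does not depend on `q`.
    have key : ∀ q : ℕ, ((q : ℝ) + 2) * f x₀ ≤
        action S.toFun a n + q * f z + action S.toFun b n := by
      intro q
      have hst := isStationary_periodize hn (hW' x₀) hloop (q + 2)
      have hmin := IsStationary.isMinimizing hS (by nlinarith) hst
      set c := concat a n (periodize (W z) n r) with hc
      have hac : a n = periodize (W z) n r 0 := by
        have := periodize_mul hn (hW' z) 0
        rw [zero_mul, zero_smul, latticeVec_zero, add_zero, hW0] at this
        rw [this, han]
      have hcend : c (n + q * n) = b 0 + latticeVec (q • r) := by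
        rw [hc, concat_add hac, periodize_mul hn (hW' z), hW0, hb0]
      have h1 := hmin (concat c (n + q * n) fun k => b k + latticeVec (q • r)) ?_ ?_
      · have h2 : (q + 2) * n = (n + q * n) + n := by ring
        rw [hL.action_periodize hn (hW' x₀), h2, action_concat _ hcend, action_concat _ hac,
          hL.action_periodize hn (hW' z), hL.action_add_latticeVec] at h1
        push_cast at h1
        exact h1
      · rw [concat_of_le (Nat.zero_le _), hc, concat_of_le (Nat.zero_le _), ha0]
        have := periodize_mul hn (hW' x₀) 0
        rw [zero_mul, zero_smul, latticeVec_zero, add_zero, hW0] at this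
        exact this.symm
      · have h2 : (q + 2) * n = (n + q * n) + n := by ring
        rw [periodize_mul hn (hW' x₀), hW0, h2, concat_add hcend, hbn, add_smul, latticeVec_add,
          latticeVec_nsmul 2]
        abel
    by_contra! hlt
    obtain ⟨q, hq⟩ := exists_nat_gt
      ((action S.toFun a n + action S.toFun b n - 2 * f x₀) / (f x₀ - f z))
    rw [div_lt_iff₀ (by linarith)] at hq
    have := key q
    nlinarith
  refine ⟨W x, hW0 x, hWn x, ?_⟩
  exact ((hmax x).trans (hconst (w 0))).trans (hf (w 0) w rfl hw)

end GeneratingFunction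

end TwistMap

namespace TwistMap

variable {d : ℕ}

theorem action_update_succ (L : E d × E d → ℝ) (p : ℕ → E d) (m : ℕ) (y : E d) :
    action L (Function.update p (m + 1) y) (m + 1) = action L p m + L (p m, y) := by
  rw [action, Finset.sum_range_succ, Function.update_self, Function.update_of_ne (by omega)]
  congr 1
  refine action_congr fun k hk => Function.update_of_ne (by omega) _ _

/-! ### Subsolutions -/

namespace PeriodicCost

variable {L : E d × E d → ℝ} (hL : PeriodicCost L)
include hL

/-- The periodized loop has its mean action as a limit point of the averages. -/
theorem mul_holonomicValue_le {w : ℕ → E d} {n : ℕ} {r : Fin d → ℤ} (hn : 1 ≤ n)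
    (hw : w n = w 0 + latticeVec r) : n * holonomicValue L ≤ action L w n := by
  obtain ⟨C, hC0, hC⟩ := hL.exists_lower_bound
  have hn0 : (0 : ℝ) < n := by exact_mod_cast hn
  -- Keeps the infimum away from `⊥`, where `EReal.toReal` takes the default value 0.
  have hlow : ((-C : ℝ) : EReal) ≤
      ⨅ x : ℕ → E d, liminf (fun n : ℕ => ((action L x n / n : ℝ) : EReal)) atTop := by
    refine le_iInf fun x => le_liminf_of_le (by isBoundedDefault) ?_
    filter_upwards [eventually_ge_atTop 1] with N hN
    have hN0 : (0 : ℝ) < N := by exact_mod_cast hN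
    rw [EReal.coe_le_coe_iff, le_div_iff₀ hN0]
    calc -C * N = ∑ _k ∈ Finset.range N, -C := by simp; ring
      _ ≤ action L x N := Finset.sum_le_sum fun k _ => hC _
  have hupp : (⨅ x : ℕ → E d, liminf (fun n : ℕ => ((action L x n / n : ℝ) : EReal)) atTop) ≤
      ((action L w n / n : ℝ) : EReal) := by
    refine (iInf_le _ (periodize w n r)).trans (liminf_le_of_frequently_le' ?_)
    refine frequently_atTop.2 fun N => ⟨(N + 1) * n, by nlinarith, ?_⟩
    rw [EReal.coe_le_coe_iff, hL.action_periodize hn hw]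
    refine le_of_eq ?_
    push_cast
    field_simp
  have h := EReal.toReal_le_toReal hupp (ne_bot_of_le_ne_bot (EReal.coe_ne_bot _) hlow)
    (EReal.coe_ne_top _)
  rw [EReal.toReal_coe, le_div_iff₀ hn0] at h
  rw [mul_comm]
  exact h

/-- One extra edge of bounded length closes any path to a loop modulo the lattice. -/
theorem exists_le_action_sub : ∃ C, ∀ (n : ℕ) (p : ℕ → E d),
    -C ≤ action L p n - n * holonomicValue L := by
  obtain ⟨C, hC⟩ := hL.exists_abs_le (Real.sqrt d)
  refine ⟨C - holonomicValue L, fun n p => ?_⟩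
  obtain ⟨r, hr⟩ := exists_norm_sub_latticeVec_le (p n - p 0)
  have h1 := hL.mul_holonomicValue_le (w := Function.update p (n + 1) (p 0 + latticeVec r))
    (n := n + 1) (r := r) (by omega) (by
      rw [Function.update_self, Function.update_of_ne (by omega)])
  rw [action_update_succ] at h1
  have h2 := (abs_le.1 (hC (p n) (p 0 + latticeVec r) (by rwa [← sub_sub]))).2
  push_cast at h1
  linarith

/-- There is a continuous periodic critical subsolution. -/
theorem exists_subsolution : ∃ v : E d → ℝ, Continuous v ∧
    (∀ (r : Fin d → ℤ) x, v (x + latticeVec r) = v x) ∧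
    ∀ x y, 0 ≤ L (x, y) + v x - v y - holonomicValue L := by
  set l := holonomicValue L
  obtain ⟨C, hC⟩ := hL.exists_le_action_sub
  -- Normalized actions of all paths ending at `x` with free starting point. Their infimum is finite
  -- by `hC`, periodic by translating paths, and a subsolution by appending an edge.
  let A : E d → Set ℝ := fun x =>
    {a | ∃ (n : ℕ) (p : ℕ → E d), 1 ≤ n ∧ p n = x ∧ action L p n - n * l = a}
  let v : E d → ℝ := fun x => sInf (A x)
  have hbdd : ∀ x, BddBelow (A x) := fun x => ⟨-C, by
    rintro _ ⟨n, p, -, -, rfl⟩; exact hC n p⟩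
  have hle : ∀ {n : ℕ} {p : ℕ → E d} {x : E d}, 1 ≤ n → p n = x →
      v x ≤ action L p n - n * l := fun hn hp => csInf_le (hbdd _) ⟨_, _, hn, hp, rfl⟩
  have hdiag : ∀ x, v x ≤ L (x, x) - l := fun x => by
    simpa [action] using hle (n := 1) (p := fun _ => x) le_rfl rfl
  have hlt : ∀ x {ε : ℝ}, 0 < ε → ∃ (m : ℕ) (p : ℕ → E d), p (m + 1) = x ∧
      action L p (m + 1) - (m + 1 : ℕ) * l < v x + ε := by
    intro x ε hε
    have hne : (A x).Nonempty := ⟨_, 1, fun _ => x, le_rfl, rfl, rfl⟩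
    obtain ⟨_, ⟨n, p, hn, hp, rfl⟩, ha⟩ := exists_lt_of_csInf_lt hne
      (show sInf (A x) < v x + ε by simp only [v]; linarith)
    obtain ⟨m, rfl⟩ := Nat.exists_eq_add_of_le' hn
    exact ⟨m, p, hp, ha⟩
  have hsub : ∀ x y, v y ≤ v x + (L (x, y) - l) := by
    intro x y
    refine le_of_forall_pos_lt_add fun ε hε => ?_
    obtain ⟨m, p, hp, h⟩ := hlt x hε
    have h1 := hle (n := m + 1 + 1) (p := Function.update p (m + 1 + 1) y) (by omega)
      (Function.update_self _ _ _)
    rw [action_update_succ, hp] at h1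
    push_cast at h h1
    linarith
  have hper : ∀ (r : Fin d → ℤ) x, v (x + latticeVec r) ≤ v x := by
    intro r x
    refine le_of_forall_pos_lt_add fun ε hε => ?_
    obtain ⟨m, p, hp, h⟩ := hlt x hε
    have h1 := hle (n := m + 1) (p := fun k => p k + latticeVec r) (by omega)
      (by rw [hp])
    rw [hL.action_add_latticeVec] at h1
    linarith
  have hcont : Continuous v := by
    obtain ⟨C₁, hC₁⟩ := hL.exists_abs_le 0
    -- For an almost optimal path ending at `x`, the total is at most `C₁ - l + 1` by comparison
    -- with the constant edge, and the part before the last edge is at least `-C`. So the last edge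
    -- costs at most `C₁ + 1 + C` and has bounded length; moving only its endpoint gives a uniform
    -- modulus of continuity.
    obtain ⟨R, hR⟩ := hL.coercive (C₁ + 1 + C)
    refine UniformContinuous.continuous (Metric.uniformContinuous_iff.2 fun ε hε => ?_)
    obtain ⟨δ, hδ, hunif⟩ := hL.uniformContinuous_of_bounded R (half_pos hε)
    have key : ∀ x y, dist x y < δ → v y < v x + ε := by
      intro x y hxy
      obtain ⟨m, p, hp, h⟩ := hlt x (ε := min (ε / 2) 1) (by positivity)
      have h1 : action L p (m + 1) = action L p m + L (p m, x) := by
        rw [action, Finset.sum_range_succ, hp]; rfl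
      have h2 := hC m p
      have h3 := (abs_le.1 (hC₁ x x (by simp))).2
      have h4 := hdiag x
      have h5 := min_le_right (ε / 2) 1
      have h6 := min_le_left (ε / 2) 1
      push_cast at h
      have h7 : ‖p m - x‖ ≤ R := hR _ _ (by linarith)
      have h8 := (abs_lt.1 (hunif (p m) x (p m) y h7 (by simpa using hδ)
        (by rwa [← dist_eq_norm, dist_comm]))).2
      have h9 := hle (n := m + 1) (p := Function.update p (m + 1) y) (by omega)
        (Function.update_self _ _ _)
      rw [action_update_succ] at h9
      push_cast at h9
      linarith
    refine ⟨δ, hδ, fun {x y} hxy => ?_⟩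
    rw [Real.dist_eq, abs_lt]
    have h1 := key x y hxy
    have h2 := key y x (by rwa [dist_comm])
    constructor <;> linarith
  refine ⟨v, hcont, fun r x => le_antisymm (hper r x) ?_, fun x y => by linarith [hsub x y]⟩
  have := hper (-r) (x + latticeVec r)
  rwa [latticeVec_neg, add_neg_cancel_right] at this

end PeriodicCost

/-! ### Static pairs of nonnegative costs -/

/-- A pair `(x, y)` is approximated by the first edges of loops of small cost. -/
def IsStaticPair (c : E d × E d → ℝ) (x y : E d) : Prop :=
  ∀ ε : ℝ, 0 < ε → ∃ (n : ℕ) (r : Fin d → ℤ) (p : ℕ → E d), 1 ≤ n ∧ p n = p 0 + latticeVec r ∧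
    ‖x - p 0‖ < ε ∧ ‖y - p 1‖ < ε ∧ action c p n < ε

theorem le_action {c : E d × E d → ℝ} (h0 : ∀ z, 0 ≤ c z) (p : ℕ → E d) {k n : ℕ} (hk : k < n) :
    c (p k, p (k + 1)) ≤ action c p n :=
  Finset.single_le_sum (f := fun k => c (p k, p (k + 1))) (fun _ _ => h0 _)
    (Finset.mem_range.2 hk)

theorem PeriodicCost.isStaticPair_add_latticeVec {c : E d × E d → ℝ} (hc : PeriodicCost c)
    {x y : E d} (h : IsStaticPair c x y) (r : Fin d → ℤ) :
    IsStaticPair c (x + latticeVec r) (y + latticeVec r) := by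
  intro ε hε
  obtain ⟨n, s, p, hn, hp, h1, h2, h3⟩ := h ε hε
  refine ⟨n, s, fun k => p k + latticeVec r, hn, ?_, by simpa using h1, by simpa using h2, ?_⟩
  · simp only [hp]; abel
  · rwa [hc.action_add_latticeVec]

theorem IsStaticPair.eq_zero {c : E d × E d → ℝ} (hc : Continuous c) (h0 : ∀ z, 0 ≤ c z)
    {x y : E d} (h : IsStaticPair c x y) : c (x, y) = 0 := by
  refine le_antisymm (le_of_forall_pos_lt_add fun ε hε => ?_) (h0 _)
  obtain ⟨δ, hδ, hcont⟩ := Metric.continuous_iff.1 hc (x, y) (ε / 2) (half_pos hε)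
  obtain ⟨n, r, p, hn, -, h1, h2, h3⟩ := h (min δ (ε / 2)) (by positivity)
  have h4 := hcont (p 0, p 1) (by
    rw [Prod.dist_eq, max_lt_iff, dist_comm, dist_eq_norm, dist_comm (p 1), dist_eq_norm]
    exact ⟨h1.trans_le (min_le_left _ _), h2.trans_le (min_le_left _ _)⟩)
  rw [Real.dist_eq, abs_lt] at h4
  have h5 := le_action h0 p (k := 0) (n := n) (by omega)
  have h6 := min_le_right δ (ε / 2)
  rw [zero_add] at h5
  linarith [h4.1]

/-- Start the almost free loops one step later. Their new first edges have bounded length by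
coercivity, so their endpoints accumulate at some `z`. -/
theorem IsStaticPair.exists_next {c : E d × E d → ℝ} (hc : PeriodicCost c) (h0 : ∀ z, 0 ≤ c z)
    {x y : E d} (h : IsStaticPair c x y) : ∃ z, IsStaticPair c y z := by
  obtain ⟨R, hR⟩ := hc.coercive 1
  have hex : ∀ ε : ℝ, 0 < ε → ∃ q : ℕ → E d, (∃ (n : ℕ) (r : Fin d → ℤ), 1 ≤ n ∧
      q n = q 0 + latticeVec r ∧ action c q n < ε) ∧ ‖y - q 0‖ < ε := by
    intro ε hε
    obtain ⟨n, r, p, hn, hp, -, h2, h3⟩ := h ε hε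
    set P := periodize p n r
    have hP : ∀ j ≤ n, P j = p j := fun j hj => by
      have := periodize_mul_add hn hp 0 hj
      simpa using this
    have hP' : ∀ j ≤ n, P (n + j) = p j + latticeVec r := fun j hj => by
      have := periodize_mul_add hn hp 1 hj
      simpa using this
    refine ⟨fun k => P (1 + k), ⟨n, r, hn, ?_, ?_⟩, ?_⟩
    · change P (1 + n) = P 1 + latticeVec r
      rw [add_comm 1 n, hP' 1 hn, hP 1 hn]
    · have e1 := action_add c P 1 n
      have e2 := action_add c P n 1
      have e3 : action c (fun k => P (n + k)) 1 = action c P 1 := by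
        simp only [action, Finset.sum_range_one, zero_add]
        rw [hP' 0 (Nat.zero_le _), hP' 1 hn, hP 0 (Nat.zero_le _), hP 1 hn, hc.periodic]
      rw [add_comm 1 n] at e1
      have e4 : action c P n = action c p n := action_congr hP
      linarith
    · change ‖y - P 1‖ < ε
      rwa [hP 1 hn]
  choose! q hq hqy using hex
  let t : ℕ → ℝ := fun j => 1 / ((j : ℝ) + 1)
  have ht0 : ∀ j, 0 < t j := fun j => Nat.one_div_pos_of_nat
  have ht1 : ∀ j, t j ≤ 1 := fun j => by
    rw [div_le_one (by positivity)]
    linarith [(Nat.cast_nonneg j : (0 : ℝ) ≤ j)]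
  have hb : ∀ j, q (t j) 1 ∈ Metric.closedBall y (1 + R) := by
    intro j
    obtain ⟨n, r, hn, -, h1⟩ := hq _ (ht0 j)
    have h2 := le_action h0 (q (t j)) (k := 0) (n := n) (by omega)
    have h3 := hR (q (t j) 0) (q (t j) 1) (by linarith [ht1 j, show c (q (t j) 0, q (t j) 1) ≤ _ from h2])
    have h4 := hqy _ (ht0 j)
    rw [Metric.mem_closedBall, dist_comm, dist_eq_norm]
    exact (norm_sub_le_norm_sub_add_norm_sub y (q (t j) 0) _).trans (by linarith [ht1 j])
  obtain ⟨z, -, φ, hφ, hz⟩ := (isCompact_closedBall y (1 + R)).tendsto_subseq hb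
  refine ⟨z, fun ε hε => ?_⟩
  have ht : Tendsto t atTop (𝓝 0) := tendsto_one_div_add_atTop_nhds_zero_nat
  obtain ⟨j, hj1, hj2⟩ := ((Metric.tendsto_nhds.1 hz ε hε).and
    ((ht.comp hφ.tendsto_atTop).eventually_lt_const hε)).exists
  obtain ⟨n, r, hn, hr, h1⟩ := hq _ (ht0 (φ j))
  have hj2' : t (φ j) < ε := hj2
  refine ⟨n, r, q (t (φ j)), hn, hr, (hqy _ (ht0 _)).trans hj2', ?_, h1.trans hj2'⟩
  rwa [← dist_eq_norm, dist_comm]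

theorem exists_eq_zero_of_forall_pos {g : E d → ℝ} (hg : Continuous g) (h0 : ∀ z, 0 ≤ g z)
    {x : E d} {R : ℝ} (hR : ∀ z, g z ≤ 1 → ‖z - x‖ ≤ R) (h : ∀ ε > 0, ∃ z, g z < ε) :
    ∃ z, g z = 0 := by
  have hmem : ∀ z, g z ≤ 1 → z ∈ Metric.closedBall x R := fun z hz => by
    rw [Metric.mem_closedBall, dist_eq_norm]; exact hR z hz
  obtain ⟨z₁, hz₁⟩ := h 1 one_pos
  obtain ⟨z, -, hz⟩ := (isCompact_closedBall x R).exists_isMinOn ⟨z₁, hmem _ hz₁.le⟩ hg.continuousOn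
  refine ⟨z, le_antisymm (le_of_forall_pos_lt_add fun ε hε => ?_) (h0 z)⟩
  obtain ⟨y, hy⟩ := h (min ε 1) (by positivity)
  have h1 : g z ≤ g y := hz (hmem y (hy.le.trans (min_le_right _ _)))
  linarith [min_le_left ε 1]

/-! ### Reduced costs -/

namespace GeneratingFunction

variable (S : GeneratingFunction d)

/-- The cost `S(x, y) + φ(x) - φ(y) - l`. -/
def reducedCost (φ : E d → ℝ) (l : ℝ) (z : E d × E d) : ℝ :=
  S.toFun z + φ z.1 - φ z.2 - l

/-- The reduced cost is nonnegative and is a periodic cost. -/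
structure IsReduction (φ : E d → ℝ) (l : ℝ) : Prop where
  periodicCost : PeriodicCost (S.reducedCost φ l)
  nonneg : ∀ z, 0 ≤ S.reducedCost φ l z

variable {S}

theorem action_reducedCost (φ : E d → ℝ) (l : ℝ) (p : ℕ → E d) (n : ℕ) :
    action (S.reducedCost φ l) p n = action S.toFun p n + φ (p 0) - φ (p n) - n * l := by
  induction n with
  | zero => simp [action]
  | succ n ih =>
    have h : ∀ L : E d × E d → ℝ, action L p (n + 1) = action L p n + L (p n, p (n + 1)) :=
      fun L => Finset.sum_range_succ _ _
    rw [h, h, ih]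
    simp only [reducedCost]
    push_cast
    ring

namespace IsReduction

variable {φ φ' : E d → ℝ} {l l' : ℝ} (h : S.IsReduction φ l) (h' : S.IsReduction φ' l')
include h

/-- Both the reduced cost and `S` are invariant under the diagonal lattice action, so the increment
of `φ` over a lattice vector has no room to depend on the point. -/
theorem add_latticeVec (r : Fin d → ℤ) (x : E d) :
    φ (x + latticeVec r) - φ x = φ (latticeVec r) - φ 0 := by
  have h1 := h.periodicCost.periodic r x 0
  have h2 := S.periodic r x 0
  simp only [reducedCost, zero_add] at h1 h2
  linarith

/-- For loops with `n` steps and displacement `r`, reduced action and action differ by a constant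
determined by `(n, r)`. A comparison of actions thus passes to all reductions at once. -/
theorem action_le_of_loops {p q : ℕ → E d} {n : ℕ} {r : Fin d → ℤ}
    (hp : p n = p 0 + latticeVec r) (hq : q n = q 0 + latticeVec r)
    (hpq : action S.toFun p n ≤ action S.toFun q n) :
    action (S.reducedCost φ l) p n ≤ action (S.reducedCost φ l) q n := by
  rw [action_reducedCost, action_reducedCost, hp, hq]
  linarith [h.add_latticeVec r (p 0), h.add_latticeVec r (q 0)]

/-- A point in the middle of two edges of zero cost satisfies the Euler-Lagrange equation. -/
theorem euler_lagrange {x y z : E d} (h1 : S.reducedCost φ l (x, y) = 0)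
    (h2 : S.reducedCost φ l (y, z) = 0) : S.d₂ x y + S.d₁ y z = 0 := by
  -- The terms in `φ` at the middle point cancel, so no regularity of `φ` is needed.
  have hmin : IsLocalMin (fun y => S.toFun (x, y) + S.toFun (y, z)) y := by
    refine Eventually.of_forall fun y' => ?_
    have h3 := h.nonneg (x, y')
    have h4 := h.nonneg (y', z)
    simp only [reducedCost] at h1 h2 h3 h4 ⊢
    linarith
  have e1 : HasFDerivAt (fun y : E d => (x, y)) (ContinuousLinearMap.inr ℝ (E d) (E d)) y :=
    (hasFDerivAt_const x y).prodMk (hasFDerivAt_id y)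
  have e2 : HasFDerivAt (fun y : E d => (y, z)) (ContinuousLinearMap.inl ℝ (E d) (E d)) y :=
    (hasFDerivAt_id y).prodMk (hasFDerivAt_const z y)
  exact hmin.hasFDerivAt_eq_zero (((S.differentiable (x, y)).hasFDerivAt.comp y e1).add
    ((S.differentiable (y, z)).hasFDerivAt.comp y e2))

include h'

/-- Each reduction provides a static successor of `y`. By the Euler-Lagrange equation both
successors give `∂₁S(y, ·)` the value `-∂₂S(x, y)`, so they agree by the twist condition, and the
construction can be iterated. -/
theorem exists_orbit {x y : E d} (hs : IsStaticPair (S.reducedCost φ l) x y)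
    (hs' : IsStaticPair (S.reducedCost φ' l') x y) : ∃ X : ℕ → E d, ∀ k,
      S.reducedCost φ l (X k, X (k + 1)) = 0 ∧ S.reducedCost φ' l' (X k, X (k + 1)) = 0 := by
  let Q : E d × E d → Prop := fun z =>
    IsStaticPair (S.reducedCost φ l) z.1 z.2 ∧ IsStaticPair (S.reducedCost φ' l') z.1 z.2
  have hzero : ∀ z, Q z → S.reducedCost φ l z = 0 ∧ S.reducedCost φ' l' z = 0 := fun z hz =>
    ⟨hz.1.eq_zero h.periodicCost.continuous h.nonneg,
      hz.2.eq_zero h'.periodicCost.continuous h'.nonneg⟩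
  have hnext : ∀ z : {z // Q z}, ∃ w : {z // Q z}, w.1.1 = z.1.2 := by
    rintro ⟨⟨x, y⟩, hz⟩
    obtain ⟨z₁, hz₁⟩ := hz.1.exists_next h.periodicCost h.nonneg
    obtain ⟨z₂, hz₂⟩ := hz.2.exists_next h'.periodicCost h'.nonneg
    have e1 := h.euler_lagrange (hzero _ hz).1
      (hz₁.eq_zero h.periodicCost.continuous h.nonneg)
    have e2 := h'.euler_lagrange (hzero _ hz).2
      (hz₂.eq_zero h'.periodicCost.continuous h'.nonneg)
    have e3 : z₁ = z₂ := (S.d₁_bijective y).1 (add_left_cancel (e1.trans e2.symm))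
    exact ⟨⟨(y, z₁), hz₁, e3 ▸ hz₂⟩, rfl⟩
  choose f hf using hnext
  let Z : ℕ → {z // Q z} := fun k => f^[k] ⟨(x, y), hs, hs'⟩
  refine ⟨fun k => (Z k).1.1, fun k => ?_⟩
  have hk : (Z (k + 1)).1.1 = (Z k).1.2 := by
    simp only [Z, Function.iterate_succ_apply', hf]
  simp only [hk]
  exact hzero _ (Z k).2

/-- Modulo the lattice the orbit returns close to itself. Replacing the endpoint of a nearly closed
piece by the exact translate of its start changes only the last edge, whose cost stays small by
uniform continuity. -/
theorem exists_small_loop {X : ℕ → E d} (hX : ∀ k, S.reducedCost φ l (X k, X (k + 1)) = 0 ∧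
    S.reducedCost φ' l' (X k, X (k + 1)) = 0) {ε : ℝ} (hε : 0 < ε) :
    ∃ (n : ℕ) (r : Fin d → ℤ) (p : ℕ → E d), 1 ≤ n ∧ p n = p 0 + latticeVec r ∧
      action (S.reducedCost φ l) p n < ε ∧ action (S.reducedCost φ' l') p n < ε := by
  obtain ⟨R, hR⟩ := h.periodicCost.coercive 0
  obtain ⟨δ, hδ, hu⟩ := h.periodicCost.uniformContinuous_of_bounded R hε
  obtain ⟨δ', hδ', hu'⟩ := h'.periodicCost.uniformContinuous_of_bounded R hε
  choose s hs using fun k => exists_norm_sub_latticeVec_le (X k)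
  obtain ⟨a, -, ψ, hψ, ha⟩ := (isCompact_closedBall (0 : E d) (Real.sqrt d)).tendsto_subseq
    (x := fun k => X k - latticeVec (s k)) fun k => by simpa using hs k
  obtain ⟨N, hN⟩ := Metric.cauchySeq_iff.1 ha.cauchySeq (min δ δ') (by positivity)
  set i := ψ N
  set j := ψ (N + 1)
  have hij : i < j := hψ (Nat.lt_succ_self N)
  have hd := hN N le_rfl (N + 1) (Nat.le_succ N)
  obtain ⟨m, hm⟩ : ∃ m, j = i + (m + 1) := ⟨j - i - 1, by omega⟩
  have hclose : ‖X i + latticeVec (s j - s i) - X j‖ < min δ δ' := by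
    have e : X i + latticeVec (s j - s i) - X j =
        (X i - latticeVec (s i)) - (X j - latticeVec (s j)) := by
      rw [latticeVec_sub]; abel
    rw [e, ← dist_eq_norm]
    exact hd
  set p := Function.update (fun k => X (i + k)) (m + 1) (X i + latticeVec (s j - s i))
  have hedge : ∀ c : E d × E d → ℝ, (∀ k, c (X k, X (k + 1)) = 0) →
      action c p (m + 1) = c (X (i + m), X i + latticeVec (s j - s i)) := by
    intro c hc
    rw [action_update_succ]
    have : action c (fun k => X (i + k)) m = 0 := Finset.sum_eq_zero fun k _ => hc (i + k)
    rw [this, zero_add]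
  have hXR : ‖X (i + m) - X j‖ ≤ R := by
    have := hX (i + m)
    rw [add_assoc, ← hm] at this
    exact hR _ _ this.1.le
  have hzero := hX (i + m)
  rw [add_assoc, ← hm] at hzero
  refine ⟨m + 1, s j - s i, p, by omega, ?_, ?_, ?_⟩
  · simp only [p, Function.update_self]
    rw [Function.update_of_ne (by omega), add_zero]
  · rw [hedge _ fun k => (hX k).1]
    have := hu _ _ (X (i + m)) (X i + latticeVec (s j - s i)) hXR (by simpa using hδ)
      (hclose.trans_le (min_le_left _ _))
    rw [hzero.1, sub_zero] at this
    exact (le_abs_self _).trans_lt this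
  · rw [hedge _ fun k => (hX k).2]
    have := hu' _ _ (X (i + m)) (X i + latticeVec (s j - s i)) hXR (by simpa using hδ')
      (hclose.trans_le (min_le_right _ _))
    rw [hzero.2, sub_zero] at this
    exact (le_abs_self _).trans_lt this

theorem exists_calibrated_edges (hS : S.WithoutConjugatePoints) {x₀ y₀ : E d}
    (hs : IsStaticPair (S.reducedCost φ l) x₀ y₀)
    (hs' : IsStaticPair (S.reducedCost φ' l') x₀ y₀) (x : E d) :
    (∃ y, S.reducedCost φ l (x, y) = 0 ∧ S.reducedCost φ' l' (x, y) = 0) ∧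
    ∃ w, S.reducedCost φ l (w, x) = 0 ∧ S.reducedCost φ' l' (w, x) = 0 := by
  obtain ⟨X, hX⟩ := h.exists_orbit h' hs hs'
  have hloop : ∀ ε > 0, ∃ (m : ℕ) (r : Fin d → ℤ) (p : ℕ → E d), p 0 = x ∧
      p (m + 1) = x + latticeVec r ∧
      action (S.reducedCost φ l) p (m + 1) < ε / 2 ∧
      action (S.reducedCost φ' l') p (m + 1) < ε / 2 := by
    intro ε hε
    obtain ⟨n, r, q, hn, hq, h1, h2⟩ := h.exists_small_loop h' hX (half_pos hε)
    -- The absence of conjugate points moves the loop to the base point `x` without increasing the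
    -- action, hence without increasing either reduced cost.
    obtain ⟨p, hp0, hpn, hpq⟩ := hS.exists_loop_action_le hn hq x
    obtain ⟨m, rfl⟩ := Nat.exists_eq_add_of_le' hn
    have hp : p (m + 1) = p 0 + latticeVec r := by rw [hp0, hpn]
    exact ⟨m, r, p, hp0, hpn, (h.action_le_of_loops hp hq hpq).trans_lt h1,
      (h'.action_le_of_loops hp hq hpq).trans_lt h2⟩
  have hc := h.periodicCost.continuous
  have hc' := h'.periodicCost.continuous
  obtain ⟨R, hR⟩ := h.periodicCost.coercive 1
  constructor
  · have hR' : ∀ y, S.reducedCost φ l (x, y) + S.reducedCost φ' l' (x, y) ≤ 1 → ‖y - x‖ ≤ R :=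
      fun y hy => by
        rw [norm_sub_rev]
        exact hR _ _ (by linarith [h'.nonneg (x, y)])
    -- Working with the sum of the two costs makes a single `y` serve both reductions.
    obtain ⟨y, hy⟩ := exists_eq_zero_of_forall_pos (by fun_prop)
      (fun y => add_nonneg (h.nonneg _) (h'.nonneg _)) hR' fun ε hε => by
        obtain ⟨m, r, p, hp0, -, h1, h2⟩ := hloop ε hε
        have h3 := le_action h.nonneg p (k := 0) (n := m + 1) (by omega)
        have h4 := le_action h'.nonneg p (k := 0) (n := m + 1) (by omega)
        rw [hp0] at h3 h4
        exact ⟨p (0 + 1), by linarith⟩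
    have h1 := h.nonneg (x, y)
    have h2 := h'.nonneg (x, y)
    exact ⟨y, by linarith, by linarith⟩
  · have hR' : ∀ w, S.reducedCost φ l (w, x) + S.reducedCost φ' l' (w, x) ≤ 1 → ‖w - x‖ ≤ R :=
      fun w hw => hR _ _ (by linarith [h'.nonneg (w, x)])
    obtain ⟨w, hw⟩ := exists_eq_zero_of_forall_pos (by fun_prop)
      (fun w => add_nonneg (h.nonneg _) (h'.nonneg _)) hR' fun ε hε => by
        obtain ⟨m, r, p, -, hpn, h1, h2⟩ := hloop ε hε
        have h3 := le_action h.nonneg p (k := m) (n := m + 1) (by omega)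
        have h4 := le_action h'.nonneg p (k := m) (n := m + 1) (by omega)
        -- The last edge ends at `x + r`, so it is translated back to end at `x`.
        have e : p m = (p m - latticeVec r) + latticeVec r := by abel
        rw [hpn, e, h.periodicCost.periodic] at h3
        rw [hpn, e, h'.periodicCost.periodic] at h4
        exact ⟨p m - latticeVec r, by linarith⟩
    have h1 := h.nonneg (w, x)
    have h2 := h'.nonneg (w, x)
    exact ⟨w, by linarith, by linarith⟩

/-- Without conjugate points, two reductions with a common static pair differ by a constant. -/
theorem sub_eq_const (hS : S.WithoutConjugatePoints) {x₀ y₀ : E d}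
    (hs : IsStaticPair (S.reducedCost φ l) x₀ y₀)
    (hs' : IsStaticPair (S.reducedCost φ' l') x₀ y₀) (x y : E d) :
    φ x - φ' x = φ y - φ' y := by
  have hD : ∀ x, HasFDerivAt (fun x => φ x - φ' x) (0 : E d →L[ℝ] ℝ) x := by
    intro x
    obtain ⟨⟨y, hy, hy'⟩, w, hw, hw'⟩ := h.exists_calibrated_edges h' hS hs hs' x
    let G : E d → ℝ := fun z => S.toFun (w, z) + S.toFun (z, y)
    have hG : Differentiable ℝ G :=
      (S.differentiable.comp (by fun_prop)).add (S.differentiable.comp (by fun_prop))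
    -- The edge from `w` bounds the increments of `φ` and `φ'` above by that of `S(w, ·)`; the edge
    -- to `y` bounds them below by minus that of `S(·, y)`. Subtracting gives both signs.
    have hle : ∀ z, |(φ z - φ' z) - (φ x - φ' x)| ≤ G z - G x := by
      intro z
      have a1 := h.nonneg (w, z)
      have a2 := h.nonneg (z, y)
      have a3 := h'.nonneg (w, z)
      have a4 := h'.nonneg (z, y)
      simp only [reducedCost] at a1 a2 a3 a4 hy hy' hw hw'
      rw [abs_le]
      constructor <;> simp only [G] <;> linarith
    have hmin : IsLocalMin G x := Eventually.of_forall fun z => by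
      linarith [hle z, abs_nonneg ((φ z - φ' z) - (φ x - φ' x))]
    have hGx : HasFDerivAt G (0 : E d →L[ℝ] ℝ) x := by
      rw [← hmin.fderiv_eq_zero]; exact (hG x).hasFDerivAt
    rw [hasFDerivAt_iff_isLittleO] at hGx ⊢
    refine Asymptotics.IsBigO.trans_isLittleO (Asymptotics.IsBigO.of_bound 1
      (Eventually.of_forall fun z => ?_)) hGx
    simp only [zero_apply, sub_zero, one_mul, Real.norm_eq_abs]
    exact (hle z).trans (le_abs_self _)
  exact is_const_of_fderiv_eq_zero (𝕜 := ℝ) (fun x => (hD x).differentiableAt)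
    (fun x => (hD x).fderiv) x y

end IsReduction

/-- Every primitive of a closed form gives rise to a reduction of `S`. -/
theorem exists_isReduction {u : E d → ℝ} {c : H1 d} (hu : IsPrimitive u c) :
    ∃ (v : E d → ℝ) (l : ℝ), (∀ (r : Fin d → ℤ) x, v (x + latticeVec r) = v x) ∧
      S.IsReduction (fun x => u x + v x) l ∧
      ∀ z ∈ aubrySet (shift S.toFun u),
        IsStaticPair (S.reducedCost (fun x => u x + v x) l) z.1 z.2 := by
  have hL := S.periodicCost_shift hu
  obtain ⟨v, hvc, hvp, hv⟩ := hL.exists_subsolution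
  set l := holonomicValue (shift S.toFun u) with hl
  have hred : ∀ z, S.reducedCost (fun x => u x + v x) l z =
      shift S.toFun u z + v z.1 - v z.2 - l := fun z => by
    simp only [reducedCost, shift]; ring
  obtain ⟨B, hB⟩ := exists_bound_of_periodic hvc hvp
  refine ⟨v, l, hvp, ⟨⟨?_, fun r x y => ?_, fun M => ?_⟩, fun z => ?_⟩, fun z hz ε hε => ?_⟩
  · rw [funext hred]
    have := hL.continuous
    fun_prop
  · rw [hred, hred]
    simp only [hL.periodic, hvp]
  · obtain ⟨R, hR⟩ := hL.coercive (M + l + B + B)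
    refine ⟨R, fun x y hxy => hR x y ?_⟩
    rw [hred] at hxy
    have h1 := abs_le.1 (hB x)
    have h2 := abs_le.1 (hB y)
    simp only at hxy
    linarith [h1.1, h2.2]
  · rw [hred]; exact hv z.1 z.2
  · obtain ⟨n, p, hn, ⟨r, hr⟩, h1, h2, h3⟩ := hz ε hε
    have hpn : p n = p 0 + latticeVec r := by rw [← hr]; abel
    refine ⟨n, r, p, hn, hpn, h1, h2, lt_of_eq_of_lt ?_ h3⟩
    have hsum : action (shift S.toFun u) p n = action S.toFun p n + u (p 0) - u (p n) := by
      have := S.action_reducedCost u 0 p n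
      rw [mul_zero, sub_zero] at this
      rw [← this]
      congr 1
      funext z
      simp [reducedCost, shift]
    rw [action_reducedCost, hsum, hpn, hvp]
    ring

end GeneratingFunction

/-! ### From the torus and its cohomology to the lifts -/

theorem exists_latticeVec_of_cover_eq {z w : E d × Dual d} (h : cover z = cover w) :
    (∃ r : Fin d → ℤ, w.1 = z.1 + latticeVec r) ∧ z.2 = w.2 := by
  obtain ⟨h1, h2⟩ := Prod.mk.inj h
  refine ⟨?_, h2⟩
  have hex : ∀ i, ∃ k : ℤ, w.1 i - z.1 i = k := by
    intro i
    have h3 := congrFun h1 i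
    have h4 : ((w.1 i - z.1 i : ℝ) : UnitAddCircle) = 0 := by
      rw [AddCircle.coe_sub, sub_eq_zero]; exact h3.symm
    obtain ⟨k, hk⟩ := (AddCircle.coe_eq_zero_iff (1 : ℝ)).1 h4
    exact ⟨k, by simpa using hk.symm⟩
  choose r hr using hex
  refine ⟨r, ?_⟩
  ext i
  have := hr i
  simp only [latticeVec, PiLp.add_apply]
  linarith

set_option maxSynthPendingDepth 5 in
theorem IsPrimitive.class_eq {u₁ u₂ : E d → ℝ} {c₁ c₂ : H1 d} (h₁ : IsPrimitive u₁ c₁)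
    (h₂ : IsPrimitive u₂ c₂)
    (hp : ∀ (r : Fin d → ℤ) x, u₁ (x + latticeVec r) - u₂ (x + latticeVec r) = u₁ x - u₂ x) :
    c₁ = c₂ := by
  obtain ⟨hu₁, η₁, rfl, he₁⟩ := h₁
  obtain ⟨hu₂, η₂, rfl, he₂⟩ := h₂
  refine (Submodule.Quotient.eq _).2 ?_
  refine ⟨fun x => u₁ x - u₂ x, hu₁.sub hu₂, hp, ?_⟩
  funext x
  rw [fderiv_fun_sub (hu₁.differentiable (by simp) x) (hu₂.differentiable (by simp) x), he₁, he₂]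
  rfl

end TwistMap

theorem proposition7p1 {d : ℕ} (hd : 1 ≤ d) (S : TwistMap.GeneratingFunction d)
    (hS : S.WithoutConjugatePoints) (c₁ c₂ : TwistMap.H1 d) (hc : c₁ ≠ c₂) :
    S.dualAubrySet c₁ ∩ S.dualAubrySet c₂ = ∅ := by
  refine Set.eq_empty_iff_forall_notMem.2 ?_
  rintro _ ⟨⟨_, ⟨⟨x, y⟩, ⟨u₁, hu₁, ha₁⟩, rfl⟩, rfl⟩, ⟨_, ⟨⟨x', y'⟩, ⟨u₂, hu₂, ha₂⟩, rfl⟩, hcov⟩⟩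
  obtain ⟨⟨r, hr⟩, hp⟩ := TwistMap.exists_latticeVec_of_cover_eq hcov
  replace hr : x = x' + TwistMap.latticeVec r := hr
  replace hp : -S.d₁ x' y' = -S.d₁ x y := hp
  subst hr
  -- Equal momenta over base points differing by `r` force the second points to differ by `r`, since
  -- `∂₁S(x, ·)` is injective.
  have hy : y = y' + TwistMap.latticeVec r := by
    refine (S.d₁_bijective (x' + TwistMap.latticeVec r)).1 ?_
    change S.d₁ _ y = S.d₁ _ (y' + TwistMap.latticeVec r)
    rw [S.d₁_periodic]
    exact (neg_injective hp).symm
  subst hy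
  obtain ⟨v₁, l₁, hv₁, hred₁, hst₁⟩ :=
    TwistMap.GeneratingFunction.exists_isReduction (S := S) hu₁
  obtain ⟨v₂, l₂, hv₂, hred₂, hst₂⟩ :=
    TwistMap.GeneratingFunction.exists_isReduction (S := S) hu₂
  have hs₂ := hred₂.periodicCost.isStaticPair_add_latticeVec (hst₂ _ ha₂) r
  refine hc (hu₁.class_eq hu₂ fun s z => ?_)
  -- The periodic parts `v₁` and `v₂` cancel between `z + s` and `z`, which leaves the periodicity
  -- of `u₁ - u₂`.
  have h := hred₁.sub_eq_const hred₂ hS (hst₁ _ ha₁) hs₂ (z + TwistMap.latticeVec s) z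
  simp only [hv₁, hv₂] at h
  linarith
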